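/- Setting. A state $S$ with values in an interval $\mathcal S\subseteq\mathbb R$ with nonempty interior is drawn once from a known density $p_S$ and stays fixed during the transmission. For finite alphabets $\mathcal X,\tilde{\mathcal Y},\mathcal Y$, memoryless channels $p_{\tilde Y|X,S}$ (to the decoder) and $p_{Y|X,S}$ (to the estimator) are given. A $(2^{nR},n)$ code consists of an encoder $m\mapsto x^n(m)$, $m\in\{1,\dots,\lceil 2^{nR}\rceil\}$, a decoder $\hat m(\tilde y^n)$ and an estimator $\hat s(y^n|x^n(m))\in\mathcal S$. A pair $(R,\alpha)\in\mathbb R_+^2$ is achievable if there is a sequence of $(2^{nR},n)$ codes with average error probability $P_e^{(n)}=\mathbb P(M\ne\hat M)\to0$ ($M$ uniform and independent of $S$) and $$\limsup_{n\to\infty}\ \max_{m}\ n\,\mathbb E\big[(S-\hat s(Y^n|x^n(m)))^2\big]\le\alpha ,$$ where $Y^n$ is the estimator's observation when $x^n(m)$ is sent. $\mathcal R\subseteq\mathbb R_+^2$ denotes the closure of the set of achievable pairs. Regularity is assumed: in the interior of $\mathcal S$ the density $p_S$ is continuous and positive, $p_{Y|X,S}(y|x,s)$ is $C^1$ in $s$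 and its support does not depend on $s$; and for every $p_X$ the mutual information $I(X;\tilde Y)$ at state $s$ is continuous in $s\in\mathcal S$. Let $J_{\mathsf D,x}(s)=\mathbb E\big[(\tfrac{\partial}{\partial s}\log p(Y|x,s))^2\big]$, with $Y\sim p(\cdot|x,s)$, be the Fisher information of one observation with input $x$, for $s$ in the interior of $\mathcal S$. Let $\mathcal R_{\mathsf{out}}$ be the set of pairs $(R,\alpha)\in\mathbb R_+^2$ such that, for some probability distribution $p_X$ on $\mathcal X$, $$R\le\inf_{s\in\mathcal S} I(X;\tilde Y),\qquad \alpha\ge\frac1{\mathbb E_S\big[\mathbb E_X[J_{\mathsf D,X}(S)]\big]}\qquad(1/0=\infty,\ 1/\infty=0).$$ Corollary 1. (i) $\mathcal R\subseteq\mathcal R_{\mathsf{out}}$, i.e. $\mathcal R_{\mathsf{out}}$ is an outer bound. (ii) Suppose that $\mathbb E_X[J_{\mathsf D,X}(s)]$ is not identically zero in $s$ for at least one $p_X$. Then $\mathcal R\subsetneq\mathcal R_{\mathsf{out}}$, unless there is a $p_X$ for which $\mathbb E_X[J_{\mathsf D,X}(s)]$ is independent of $s$ and not zero. (iii) More precisely,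 let $(R,\alpha)\in\mathcal R_{\mathsf{out}}$ be such that $\alpha$ is the least value with $(R,\alpha)\in\mathcal R_{\mathsf{out}}$. Then $(R,\alpha)\notin\mathcal R$, unless some $p_X$ that satisfies the two inequalities above for $(R,\alpha)$ has $\mathbb E_X[J_{\mathsf D,X}(s)]$ independent of $s$. (In (ii) and (iii), $s$ ranges over the interior of $\mathcal S$.) -/

import Mathlib

open MeasureTheory Filter Topology
open scoped ENNReal

noncomputable section

/-- The integrated sensing and communication model: a state space `S ⊆ ℝ` that is an interval with
nonempty interior, a prior density `p(s)` on it, a communication channel `p(ỹ | x, s)` and a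
sensing channel `p(y | x, s)`. The alphabets `X` (input), `Z` (receiver, the `ỹ`) and `Y`
(estimator) are finite. Only the values at states in `stateSpace` matter. -/
structure ISACModel (X Z Y : Type*) [Fintype X] [Fintype Z] [Fintype Y] where
  stateSpace : Set ℝ
  stateSpace_interval : stateSpace.OrdConnected
  stateSpace_interior : (interior stateSpace).Nonempty
  /-- the prior density `p(s)` -/
  density : ℝ → ℝ
  density_measurable : Measurable density
  density_nonneg : ∀ s ∈ stateSpace, 0 ≤ density s
  density_total : ∫⁻ s in stateSpace, ENNReal.ofReal (density s) = 1
  /-- `comm x s z` is the probability `p(ỹ = z | x, s)` -/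
  comm : X → ℝ → Z → ℝ
  comm_measurable : ∀ x z, Measurable fun s : stateSpace => comm x s z
  comm_nonneg : ∀ x, ∀ s ∈ stateSpace, ∀ z, 0 ≤ comm x s z
  comm_total : ∀ x, ∀ s ∈ stateSpace, ∑ z, comm x s z = 1
  /-- `sens x s y` is the probability `p(y | x, s)` -/
  sens : X → ℝ → Y → ℝ
  sens_measurable : ∀ x y, Measurable fun s : stateSpace => sens x s y
  sens_nonneg : ∀ x, ∀ s ∈ stateSpace, ∀ y, 0 ≤ sens x s y
  sens_total : ∀ x, ∀ s ∈ stateSpace, ∑ y, sens x s y = 1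

namespace ISACModel

variable {X Z Y : Type*} [Fintype X] [Fintype Z] [Fintype Y]

/-- The law of the state `S`. -/
def prior (M : ISACModel X Z Y) : Measure ℝ :=
  (volume.restrict M.stateSpace).withDensity fun s => ENNReal.ofReal (M.density s)

/-- The mutual information `I(X; Ỹ)` in bits, for `X ∼ p` and the communication channel at
state `s`. Terms of probability zero vanish. -/
def mutualInfo (M : ISACModel X Z Y) (p : X → ℝ) (s : ℝ) : ℝ :=
  ∑ x, ∑ z, p x * M.comm x s z * Real.logb 2 (M.comm x s z / ∑ x', p x' * M.comm x' s z)

/-- The Fisher information `J_{D,x}(s) = E[(∂/∂s log p(Y | x, s))²]`, `Y ∼ p(· | x, s)`, of a single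
observation of the sensing channel with input `x`; meaningful for `s` in the interior of the
state space, which carries the whole mass of the prior. -/
def fisherInfo (M : ISACModel X Z Y) (x : X) (s : ℝ) : ℝ :=
  ∑ y, M.sens x s y * (deriv (fun t => Real.log (M.sens x t y)) s) ^ 2

/-- `E_X[J_{D,X}(s)]` for `X ∼ p`. -/
def meanFisherInfo (M : ISACModel X Z Y) (p : X → ℝ) (s : ℝ) : ℝ :=
  ∑ x, p x * M.fisherInfo x s

/-- `E_S[E_X[J_{D,X}(S)]]` for `X ∼ p`, as an extended nonnegative real. -/
def bayesFisherInfo (M : ISACModel X Z Y) (p : X → ℝ) : ℝ≥0∞ :=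
  ∫⁻ s, ENNReal.ofReal (M.meanFisherInfo p s) ∂M.prior

/-- The regularity conditions: the prior density is continuous and positive inside the state space;
inside the state space the sensing channel is continuously differentiable in the state and its
support does not depend on the state; `I(X; Ỹ)` is continuous in the state. -/
structure Regular (M : ISACModel X Z Y) : Prop where
  density_continuous : ContinuousOn M.density (interior M.stateSpace)
  density_pos : ∀ s ∈ interior M.stateSpace, 0 < M.density s
  sens_contDiff : ∀ x y, ContDiffOn ℝ 1 (fun s => M.sens x s y) (interior M.stateSpace)
  sens_support : ∀ x y, (∀ s ∈ interior M.stateSpace, 0 < M.sens x s y) ∨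
    (∀ s ∈ interior M.stateSpace, M.sens x s y = 0)
  mutualInfo_continuous : ∀ p ∈ stdSimplex ℝ X, ContinuousOn (M.mutualInfo p) M.stateSpace

/-- The number of messages of a code of rate `R` (bits per channel use) and length `n`:
`2^{nR}`, rounded up. -/
def numMessages (R : ℝ) (n : ℕ) : ℕ := ⌈(2 : ℝ) ^ ((n : ℝ) * R)⌉₊

/-- A `(2^{nR}, n)` code: an encoder, a decoder, and an estimator that knows the codeword sent. -/
structure Code (M : ISACModel X Z Y) (R : ℝ) (n : ℕ) where
  enc : Fin (numMessages R n) → Fin n → X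
  dec : (Fin n → Z) → Fin (numMessages R n)
  est : (Fin n → X) → (Fin n → Y) → M.stateSpace

/-- The average error probability `P(M ≠ M̂)`: the message is uniform, the state is drawn from the
prior once and stays fixed, and the letters are sent through the channel independently. -/
def Code.errorProb {M : ISACModel X Z Y} {R : ℝ} {n : ℕ} (c : M.Code R n) : ℝ≥0∞ :=
  ∫⁻ s, ENNReal.ofReal ((numMessages R n : ℝ)⁻¹ * ∑ m, ∑ z : Fin n → Z,
    if c.dec z ≠ m then ∏ i, M.comm (c.enc m i) s (z i) else 0) ∂M.prior

/-- The mean-squared error `E[(S - ŝ(Yⁿ | xⁿ))²]` for the codeword `xⁿ`, over `S` and `Yⁿ`. -/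
def Code.mse {M : ISACModel X Z Y} {R : ℝ} {n : ℕ} (c : M.Code R n) (x : Fin n → X) : ℝ≥0∞ :=
  ∫⁻ s, ENNReal.ofReal (∑ y : Fin n → Y,
    (s - (c.est x y : ℝ)) ^ 2 * ∏ i, M.sens (x i) s (y i)) ∂M.prior

/-- The pair `(R, α)` is achievable: there are `(2^{nR}, n)` codes with error probability tending
to zero and `limsup_n max_{xⁿ} n · MSE(ŝ | xⁿ) ≤ α`, the maximum over the codebook. -/
def Achievable (M : ISACModel X Z Y) (R α : ℝ) : Prop :=
  ∃ c : ∀ n, M.Code R n,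
    Tendsto (fun n => (c n).errorProb) atTop (𝓝 0) ∧
    limsup (fun n : ℕ => ⨆ m, (n : ℝ≥0∞) * (c n).mse ((c n).enc m)) atTop ≤ ENNReal.ofReal α

/-- The rate-MSE decay region: the closure of the achievable pairs in `ℝ₊²`. -/
def region (M : ISACModel X Z Y) : Set (ℝ × ℝ) :=
  closure {q | 0 ≤ q.1 ∧ 0 ≤ q.2 ∧ M.Achievable q.1 q.2}

/-- The input distribution `p` satisfies `R ≤ min_s I(X; Ỹ)` and `α ≥ 1 / E_S[E_X[J_{D,X}(S)]]`,
where `1 / 0 = ∞` and `1 / ∞ = 0`. -/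
def OuterBound (M : ISACModel X Z Y) (p : X → ℝ) (R α : ℝ) : Prop :=
  R ≤ ⨅ s : M.stateSpace, M.mutualInfo p s ∧ (M.bayesFisherInfo p)⁻¹ ≤ ENNReal.ofReal α

/-- The region obtained from the Bayesian Cramér–Rao bound: the pairs in `ℝ₊²` that satisfy the
two bounds for some input distribution. -/
def outerRegion (M : ISACModel X Z Y) : Set (ℝ × ℝ) :=
  {q | 0 ≤ q.1 ∧ 0 ≤ q.2 ∧ ∃ p ∈ stdSimplex ℝ X, M.OuterBound p q.1 q.2}

/-- For `X ∼ p`, the information `E_X[J_{D,X}(s)]` does not depend on the state `s`. -/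
def FisherIndep (M : ISACModel X Z Y) (p : X → ℝ) : Prop :=
  ∀ s ∈ interior M.stateSpace, ∀ t ∈ interior M.stateSpace,
    M.meanFisherInfo p s = M.meanFisherInfo p t

/-- For `X ∼ p`, the information `E_X[J_{D,X}(s)]` is not identically zero. -/
def Informative (M : ISACModel X Z Y) (p : X → ℝ) : Prop :=
  ∃ s ∈ interior M.stateSpace, M.meanFisherInfo p s ≠ 0

end ISACModel

end

/-!
The region is confined by two constraints on one input distribution `p`, obtained for a code from its
letter distribution (the law of a uniformly chosen letter of a uniformly chosen codeword) and passed
to the limit by compactness of the simplex (`mem_constraintRegion_of_tendsto`).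

*Rate.* The error probability is small only on average over the state, hence along a subsequence at
almost every state. At such a state `fano_single_letter` bounds the rate by the mutual information of
the letter distribution. The prior has a positive density inside the state space, so these states are
dense, and continuity in the state extends the bound to all states.

*Sensing.* The prior need not vanish at the ends of the state space, so the classical Bayesian
Cramér–Rao bound is not available. Instead, the van Trees inequality is used with an arbitrary weight
`h` supported inside the state space, in place of the prior density. In a linearized form
(`two_mul_integral_le`) it reads
`2 ∫ h ≤ n · MSE + (1 / n) ∫ h'² / p_S + ∫ h² J / p_S`,
where `J` is the mean Fisher information per letter of the codeword. The right-hand side is affine in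
the letter frequencies, so it can be averaged over the codebook; therefore one letter distribution
serves for rate and sensing. In the limit `2 ∫ h ≤ α + ∫ h² J / p_S` for all `h`, first for
differentiable and then for continuous weights with compact support.

Weights `h` close to `α p_S` give `1 ≤ α E[J(S)]`, the outer bound. If equality holds, `α p_S` is a
stationary point of a quadratic functional, and its first variation `2 ∫ ψ (1 - α J)` has to vanish
for every `ψ`: thus `J = 1 / α` is constant (`SensingBound.fisherIndep`). Distortion zero, the bound
for infinite `E[J(S)]`, is excluded by any fixed weight scaled to be small (`SensingBound.pos`).
Therefore a pair of the region with the least distortion in the outer region needs an input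
distribution with constant Fisher information. Strictness of the inclusion follows at rate zero, where
a least distortion exists because `E[J(S)]` is linear in `p` and a point mass maximizes it.
-/

noncomputable section

/-! ### Sums over product distributions -/

section ProductSums

variable {ι A : Type*} [Fintype ι] [Fintype A] [DecidableEq ι]

lemma sum_prod_mul_prod (f u : ι → A → ℝ) :
    ∑ z : ι → A, (∏ i, f i (z i)) * ∏ i, u i (z i) = ∏ i, ∑ a, f i a * u i a := by
  rw [Finset.prod_univ_sum, Fintype.piFinset_univ]
  exact Finset.sum_congr rfl fun z _ => Finset.prod_mul_distrib.symm

lemma sum_prod_eq_one {f : ι → A → ℝ} (hf : ∀ i, ∑ a, f i a = 1) :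
    ∑ z : ι → A, ∏ i, f i (z i) = 1 := by
  simpa [hf] using sum_prod_mul_prod f fun _ _ => 1

lemma sum_prod_mul_apply {f : ι → A → ℝ} (hf : ∀ i, ∑ a, f i a = 1) (k : ι) (g : A → ℝ) :
    ∑ z : ι → A, (∏ i, f i (z i)) * g (z k) = ∑ a, f k a * g a := by
  have h := sum_prod_mul_prod f fun i a => if i = k then g a else 1
  rw [Finset.prod_eq_single k (fun i _ hi => by simp [hi, hf]) (by simp)] at h
  simpa using h

lemma sum_prod_mul_apply_mul_apply {f : ι → A → ℝ} (hf : ∀ i, ∑ a, f i a = 1) {k l : ι}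
    (hkl : k ≠ l) (g g' : A → ℝ) :
    ∑ z : ι → A, (∏ i, f i (z i)) * (g (z k) * g' (z l)) =
      (∑ a, f k a * g a) * ∑ a, f l a * g' a := by
  have h := sum_prod_mul_prod f fun i a => (if i = k then g a else 1) * if i = l then g' a else 1
  rw [Finset.prod_eq_mul k l hkl (fun i _ hi => by simp [hi.1, hi.2, hf]) (by simp) (by simp)] at h
  simp only [Finset.prod_mul_distrib (f := fun i => if i = k then _ else _), Finset.prod_ite_eq',
    Finset.mem_univ, if_true] at h
  simpa [hkl, hkl.symm] using h

lemma sum_prod_mul_sum {f : ι → A → ℝ} (hf : ∀ i, ∑ a, f i a = 1) (g : ι → A → ℝ) :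
    ∑ z : ι → A, (∏ i, f i (z i)) * ∑ i, g i (z i) = ∑ i, ∑ a, f i a * g i a := by
  simp_rw [Finset.mul_sum]
  rw [Finset.sum_comm]
  exact Finset.sum_congr rfl fun k _ => sum_prod_mul_apply hf k (g k)

/-- The variance of a sum of independent centered variables is the sum of the variances. -/
lemma sum_prod_mul_sum_sq {f : ι → A → ℝ} (hf : ∀ i, ∑ a, f i a = 1) {g : ι → A → ℝ}
    (hg : ∀ i, ∑ a, f i a * g i a = 0) :
    ∑ z : ι → A, (∏ i, f i (z i)) * (∑ i, g i (z i)) ^ 2 = ∑ i, ∑ a, f i a * g i a ^ 2 := by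
  simp_rw [sq, Finset.sum_mul_sum, Finset.mul_sum]
  rw [Finset.sum_comm]
  refine Finset.sum_congr rfl fun k _ => ?_
  rw [Finset.sum_comm, Finset.sum_eq_single k]
  · exact sum_prod_mul_apply hf k fun a => g k a * g k a
  · intro l _ hl
    rw [sum_prod_mul_apply_mul_apply hf hl.symm, hg k, zero_mul]
  · simp

end ProductSums

/-! ### The converse to the coding theorem -/

/-- The tangent of `a ↦ a log (a / b)` at `a = b c`. -/
lemma mul_log_div_ge {a b c : ℝ} (ha : 0 ≤ a) (hb : 0 ≤ b) (hab : b = 0 → a = 0) (hc : 0 < c) :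
    a * Real.log c + a - b * c ≤ a * Real.log (a / b) := by
  rcases ha.eq_or_lt with rfl | ha
  · simpa using mul_nonneg hb hc.le
  have hb : 0 < b := hb.lt_of_ne fun h => ha.ne' (hab h.symm)
  have h := mul_le_mul_of_nonneg_left (Real.log_le_sub_one_of_pos (x := b * c / a) (by positivity))
    ha.le
  rw [Real.log_div (by positivity) ha.ne', Real.log_mul hb.ne' hc.ne', mul_sub a (b * c / a),
    mul_div_cancel₀ _ ha.ne'] at h
  rw [Real.log_div ha.ne' hb.ne']
  linarith

section Converse

variable {X Z : Type*}

open Classical in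
/-- The input distribution of a codebook with `N` codewords of length `n`: the law of a letter at a
uniformly chosen position of a uniformly chosen codeword. -/
def letterDist {N n : ℕ} (enc : Fin N → Fin n → X) (x : X) : ℝ :=
  ((N : ℝ) * n)⁻¹ * ∑ m, ∑ i, if enc m i = x then 1 else 0

lemma letterDist_pos {N n : ℕ} (enc : Fin N → Fin n → X) (m : Fin N) (i : Fin n) :
    0 < letterDist enc (enc m i) := by
  classical
  have hN : 0 < N := m.pos
  have hn : 0 < n := i.pos
  refine mul_pos (by positivity) ?_
  refine Finset.sum_pos' (fun m _ => by positivity) ⟨m, Finset.mem_univ _, ?_⟩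
  exact Finset.sum_pos' (fun m _ => by positivity) ⟨i, Finset.mem_univ _, by simp⟩

variable [Fintype X]

lemma output_pos {p : X → ℝ} (hp : ∀ x, 0 ≤ p x) {W : X → Z → ℝ} (hW : ∀ x z, 0 ≤ W x z)
    {x : X} {z : Z} (hx : 0 < p x) (hz : 0 < W x z) : 0 < ∑ x', p x' * W x' z :=
  Finset.sum_pos' (fun x' _ => mul_nonneg (hp x') (hW x' z))
    ⟨x, Finset.mem_univ _, mul_pos hx hz⟩

lemma sum_letterDist_mul {N n : ℕ} (enc : Fin N → Fin n → X) (f : X → ℝ) :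
    ∑ x, letterDist enc x * f x = ((N : ℝ) * n)⁻¹ * ∑ m, ∑ i, f (enc m i) := by
  classical
  simp_rw [letterDist, mul_assoc, ← Finset.mul_sum, Finset.sum_mul]
  rw [Finset.sum_comm]
  congr 1
  refine Finset.sum_congr rfl fun m _ => ?_
  rw [Finset.sum_comm]
  simp

lemma letterDist_mem_stdSimplex {N n : ℕ} (hN : N ≠ 0) (hn : n ≠ 0) (enc : Fin N → Fin n → X) :
    letterDist enc ∈ stdSimplex ℝ X := by
  classical
  refine ⟨fun x => ?_, ?_⟩
  · rw [letterDist]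
    positivity
  · have h := sum_letterDist_mul enc fun _ => 1
    have : (N : ℝ) * n ≠ 0 := by positivity
    simpa only [mul_one, Finset.sum_const, Finset.card_univ, Fintype.card_fin, nsmul_eq_mul,
      inv_mul_cancel₀ this] using h

variable [Fintype Z]

lemma sum_output {p : X → ℝ} (hp : p ∈ stdSimplex ℝ X) {W : X → Z → ℝ}
    (hW1 : ∀ x, ∑ z, W x z = 1) : ∑ z, ∑ x, p x * W x z = 1 := by
  rw [Finset.sum_comm]
  simp [← Finset.mul_sum, hW1, hp.2]

/-- A strong form of Fano's inequality with the single-letter bound built in: `log N` times the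
probability of correct decoding, less a nat, is at most `n` times the mutual information (in nats)
for the letter distribution of the codebook. The divergence of the joint law of message and output
from the product of the uniform law and the `n`-th power of the single-letter output law splits
over the positions, and the product law gives correct decoding the probability `1 / N`. -/
lemma fano_single_letter {N n : ℕ} (hN : N ≠ 0) (hn : n ≠ 0) (enc : Fin N → Fin n → X)
    (dec : (Fin n → Z) → Fin N) {W : X → Z → ℝ} (hW : ∀ x z, 0 ≤ W x z)
    (hW1 : ∀ x, ∑ z, W x z = 1) :
    (1 - (N : ℝ)⁻¹ * ∑ m, ∑ z : Fin n → Z, if dec z ≠ m then ∏ i, W (enc m i) (z i) else 0)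
        * Real.log N - 1 ≤
      n * ∑ x, letterDist enc x *
        ∑ z, W x z * Real.log (W x z / ∑ x', letterDist enc x' * W x' z) := by
  have hp := letterDist_mem_stdSimplex hN hn enc
  set q : Z → ℝ := fun z => ∑ x', letterDist enc x' * W x' z with hq
  have hq0 : ∀ z, 0 ≤ q z := fun z => Finset.sum_nonneg fun x _ => mul_nonneg (hp.1 x) (hW x z)
  have hq1 : ∑ z, q z = 1 := sum_output hp hW1
  have hN1 : (0 : ℝ) < N := by positivity
  have hqW : ∀ m i z, q z = 0 → W (enc m i) z = 0 := fun m i z h => by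
    by_contra h'
    exact (output_pos hp.1 hW (letterDist_pos enc m i) ((hW _ _).lt_of_ne' h')).ne' h
  -- the divergence splits over the positions
  have hsplit : ∀ m, ∑ z : Fin n → Z, (∏ i, W (enc m i) (z i)) *
      Real.log ((∏ i, W (enc m i) (z i)) / ∏ i, q (z i)) =
      ∑ i, ∑ a, W (enc m i) a * Real.log (W (enc m i) a / q a) := fun m => by
    rw [← sum_prod_mul_sum (f := fun i => W (enc m i)) (fun i => hW1 _)
      fun i a => Real.log (W (enc m i) a / q a)]
    refine Finset.sum_congr rfl fun z _ => ?_
    by_cases h0 : ∏ i, W (enc m i) (z i) = 0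
    · simp [h0]
    · have h0' := fun i => Finset.prod_ne_zero_iff.1 h0 i (Finset.mem_univ i)
      rw [← Finset.prod_div_distrib, Real.log_prod]
      exact fun i _ => div_ne_zero (h0' i) fun h => h0' i (hqW m i _ h)
  -- the tangent has slope `log N` on the event of correct decoding, `0` elsewhere
  have htan : ∀ m (z : Fin n → Z), (∏ i, W (enc m i) (z i)) * Real.log N -
      (if dec z ≠ m then ∏ i, W (enc m i) (z i) else 0) * Real.log N + (∏ i, W (enc m i) (z i)) -
      ((∏ i, q (z i)) + (∏ i, q (z i)) * if dec z = m then (N : ℝ) else 0) ≤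
      (∏ i, W (enc m i) (z i)) * Real.log ((∏ i, W (enc m i) (z i)) / ∏ i, q (z i)) := by
    intro m z
    have ha : 0 ≤ ∏ i, W (enc m i) (z i) := Finset.prod_nonneg fun i _ => hW _ _
    have hb : 0 ≤ ∏ i, q (z i) := Finset.prod_nonneg fun i _ => hq0 _
    have hab : ∏ i, q (z i) = 0 → ∏ i, W (enc m i) (z i) = 0 := fun h => by
      obtain ⟨i, hi, h⟩ := Finset.prod_eq_zero_iff.1 h
      exact Finset.prod_eq_zero hi (hqW m i _ h)
    by_cases h : dec z = m
    · have := mul_log_div_ge ha hb hab hN1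
      simp only [h, ne_eq, not_true, if_false, if_true]
      linarith
    · have := mul_log_div_ge ha hb hab one_pos
      simp only [h, ne_eq, not_false_iff, if_true, if_false]
      simp only [Real.log_one] at this
      linarith
  have hsum := Finset.sum_le_sum fun m (_ : m ∈ Finset.univ) =>
    (Finset.sum_le_sum fun z (_ : z ∈ Finset.univ) => htan m z).trans_eq (hsplit m)
  have hW2 : ∀ m, ∑ z : Fin n → Z, ∏ i, W (enc m i) (z i) = 1 := fun m =>
    sum_prod_eq_one (f := fun i => W (enc m i)) fun i => hW1 _
  have hq2 : ∑ z : Fin n → Z, ∏ i, q (z i) = 1 := sum_prod_eq_one (f := fun _ => q) fun _ => hq1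
  have hcorr : ∑ m, ∑ z : Fin n → Z, (∏ i, q (z i)) * (if dec z = m then (N : ℝ) else 0) = N := by
    rw [Finset.sum_comm]
    simp [← Finset.sum_mul, hq2]
  simp only [Finset.sum_sub_distrib, Finset.sum_add_distrib, ← Finset.sum_mul, hW2, hq2, hcorr,
    Finset.sum_const, Finset.card_univ, Fintype.card_fin, nsmul_eq_mul, mul_one] at hsum
  rw [sum_letterDist_mul enc fun x => ∑ z, W x z * Real.log (W x z / q z)]
  have hn1 : (n : ℝ) ≠ 0 := by positivity
  rw [mul_comm (N : ℝ) n, mul_inv, mul_assoc, mul_inv_cancel_left₀ hn1,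
    ← mul_le_mul_iff_right₀ hN1, mul_inv_cancel_left₀ hN1.ne']
  refine le_trans (le_of_eq ?_) hsum
  field_simp
  ring

end Converse

namespace ISACModel

variable {X Z Y : Type*} [Fintype X] [Fintype Z] [Fintype Y]

/-! ### Mutual information -/

section MutualInfo

variable (M : ISACModel X Z Y)

lemma mutualInfo_eq (p : X → ℝ) (s : ℝ) :
    M.mutualInfo p s = (∑ x, p x * ∑ z, M.comm x s z *
      Real.log (M.comm x s z / ∑ x', p x' * M.comm x' s z)) / Real.log 2 := by
  simp_rw [mutualInfo, Real.logb, Finset.mul_sum, Finset.sum_div]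
  exact Finset.sum_congr rfl fun x _ => Finset.sum_congr rfl fun z _ => by ring

lemma mutualInfo_nonneg {p : X → ℝ} (hp : p ∈ stdSimplex ℝ X) {s : ℝ} (hs : s ∈ M.stateSpace) :
    0 ≤ M.mutualInfo p s := by
  have hW := fun x z => M.comm_nonneg x s hs z
  have hq0 : ∀ z, 0 ≤ ∑ x', p x' * M.comm x' s z := fun z =>
    Finset.sum_nonneg fun x _ => mul_nonneg (hp.1 x) (hW x z)
  rw [mutualInfo_eq]
  refine div_nonneg (Finset.sum_nonneg fun x _ => ?_) (Real.log_nonneg one_le_two)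
  rcases (hp.1 x).eq_or_lt with hx | hx
  · simp [← hx]
  refine mul_nonneg hx.le ?_
  have h := Finset.sum_le_sum fun z (_ : z ∈ Finset.univ) => mul_log_div_ge (hW x z) (hq0 z)
    (fun h => by
      by_contra h'
      exact (output_pos hp.1 hW hx ((hW x z).lt_of_ne' h')).ne' h) one_pos
  simp only [Real.log_one, mul_zero, zero_add, mul_one, Finset.sum_sub_distrib,
    sum_output hp fun x => M.comm_total x s hs, M.comm_total x s hs, sub_self] at h
  exact h

/-- Mutual information as an entropy difference; unlike in the definition, every term is continuous
in the input distribution, also where output letters have probability zero. -/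
lemma mutualInfo_eq_entropy_sub {p : X → ℝ} (hp : p ∈ stdSimplex ℝ X) {s : ℝ}
    (hs : s ∈ M.stateSpace) :
    M.mutualInfo p s = (∑ z, Real.negMulLog (∑ x, p x * M.comm x s z) +
      ∑ x, p x * ∑ z, M.comm x s z * Real.log (M.comm x s z)) / Real.log 2 := by
  have hW := fun x z => M.comm_nonneg x s hs z
  rw [mutualInfo_eq]
  congr 1
  have h : ∀ x z, p x * (M.comm x s z *
      Real.log (M.comm x s z / ∑ x', p x' * M.comm x' s z)) =
      p x * (M.comm x s z * Real.log (M.comm x s z)) -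
        p x * M.comm x s z * Real.log (∑ x', p x' * M.comm x' s z) := fun x z => by
    rcases (hp.1 x).eq_or_lt with hx | hx
    · simp [← hx]
    rcases (hW x z).eq_or_lt with hz | hz
    · simp [← hz]
    rw [Real.log_div hz.ne' (output_pos hp.1 hW hx hz).ne']
    ring
  simp_rw [Finset.mul_sum, h, Finset.sum_sub_distrib]
  rw [Finset.sum_comm (f := fun x z => p x * M.comm x s z * _)]
  simp_rw [← Finset.sum_mul, Real.negMulLog, neg_mul, Finset.sum_neg_distrib]
  ring

lemma continuousOn_mutualInfo {s : ℝ} (hs : s ∈ M.stateSpace) :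
    ContinuousOn (fun p => M.mutualInfo p s) (stdSimplex ℝ X) := by
  refine ContinuousOn.congr (Continuous.continuousOn ?_)
    fun p hp => M.mutualInfo_eq_entropy_sub hp hs
  have := Real.continuous_negMulLog
  fun_prop

end MutualInfo

/-! ### The prior -/

section Prior

variable (M : ISACModel X Z Y)

lemma measurableSet_stateSpace : MeasurableSet M.stateSpace :=
  M.stateSpace_interval.measurableSet

lemma convex_stateSpace : Convex ℝ M.stateSpace :=
  convex_iff_ordConnected.2 M.stateSpace_interval

lemma lintegral_prior (g : ℝ → ℝ≥0∞) :
    ∫⁻ s, g s ∂M.prior = ∫⁻ s in M.stateSpace, ENNReal.ofReal (M.density s) * g s := by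
  rw [prior, lintegral_withDensity_eq_lintegral_mul_non_measurable _ (by
    have := M.density_measurable
    fun_prop) (by simp)]
  rfl

lemma restrict_interior_eq :
    volume.restrict (interior M.stateSpace) = volume.restrict M.stateSpace := by
  refine Measure.restrict_congr_set (LE.le.eventuallyLE interior_subset
    |>.antisymm ?_)
  refine (ae_le_set.2 (measure_mono_null ?_ (M.convex_stateSpace.addHaar_frontier volume)))
  exact Set.sdiff_subset_sdiff_left subset_closure

lemma lintegral_prior_interior (g : ℝ → ℝ≥0∞) :
    ∫⁻ s, g s ∂M.prior =
      ∫⁻ s in interior M.stateSpace, ENNReal.ofReal (M.density s) * g s := by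
  rw [lintegral_prior, restrict_interior_eq]

instance : IsProbabilityMeasure M.prior := ⟨by
  rw [← lintegral_one, lintegral_prior]
  simpa using M.density_total⟩

/-- The prior charges every part of the interior, so what holds almost surely for the state holds
on a dense subset of the state space. -/
lemma subset_closure_of_ae_prior (hM : M.Regular) {P : ℝ → Prop} (h : ∀ᵐ s ∂M.prior, P s) :
    M.stateSpace ⊆ closure {s | s ∈ interior M.stateSpace ∧ P s} := by
  have h1 : ∀ᵐ s ∂volume.restrict (interior M.stateSpace), P s := by
    rw [prior, ← restrict_interior_eq, ae_withDensity_iff (by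
      have := M.density_measurable
      fun_prop)] at h
    filter_upwards [h, ae_restrict_mem isOpen_interior.measurableSet] with s hs hsI
    exact hs (by simpa using hM.density_pos s hsI)
  rw [ae_restrict_iff' isOpen_interior.measurableSet] at h1
  have h2 := Dense.open_subset_closure_inter
    (Measure.dense_of_ae h1) (isOpen_interior (s := M.stateSpace))
  calc M.stateSpace ⊆ closure M.stateSpace := subset_closure
    _ = closure (interior M.stateSpace) :=
      (M.convex_stateSpace.closure_interior_eq_closure_of_nonempty_interior
        M.stateSpace_interior).symm
    _ ⊆ _ := closure_minimal (h2.trans (closure_mono ?_)) isClosed_closure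
  exact fun s hs => ⟨hs.1, hs.2 hs.1⟩

end Prior

/-! ### Fisher information -/

section Fisher

variable (M : ISACModel X Z Y)

/-- The score `∂/∂s log p(y | x, s)` of an observation. -/
def score (x : X) (y : Y) (s : ℝ) : ℝ := deriv (fun t => Real.log (M.sens x t y)) s

lemma fisherInfo_nonneg (x : X) {s : ℝ} (hs : s ∈ M.stateSpace) : 0 ≤ M.fisherInfo x s :=
  Finset.sum_nonneg fun y _ => mul_nonneg (M.sens_nonneg x s hs y) (sq_nonneg _)

lemma meanFisherInfo_nonneg {p : X → ℝ} (hp : p ∈ stdSimplex ℝ X) {s : ℝ}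
    (hs : s ∈ M.stateSpace) : 0 ≤ M.meanFisherInfo p s :=
  Finset.sum_nonneg fun x _ => mul_nonneg (hp.1 x) (M.fisherInfo_nonneg x hs)

variable {M}

lemma hasDerivAt_sens (hM : M.Regular) (x : X) (y : Y) {s : ℝ} (hs : s ∈ interior M.stateSpace) :
    HasDerivAt (fun t => M.sens x t y) (M.sens x s y * M.score x y s) s := by
  have hI : interior M.stateSpace ∈ 𝓝 s := isOpen_interior.mem_nhds hs
  have hd : DifferentiableAt ℝ (fun t => M.sens x t y) s :=
    ((hM.sens_contDiff x y).contDiffAt hI).differentiableAt one_ne_zero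
  rcases hM.sens_support x y with h | h
  · have : M.score x y s = deriv (fun t => M.sens x t y) s / M.sens x s y :=
      (hd.hasDerivAt.log (h s hs).ne').deriv
    rw [this, mul_div_cancel₀ _ (h s hs).ne']
    exact hd.hasDerivAt
  · rw [h s hs, zero_mul]
    exact (hasDerivAt_const s (0 : ℝ)).congr_of_eventuallyEq (by filter_upwards [hI] using h)

lemma continuousOn_sens (hM : M.Regular) (x : X) (y : Y) :
    ContinuousOn (fun s => M.sens x s y) (interior M.stateSpace) :=
  (hM.sens_contDiff x y).continuousOn

lemma continuousOn_score (hM : M.Regular) (x : X) (y : Y) :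
    ContinuousOn (M.score x y) (interior M.stateSpace) := by
  rcases hM.sens_support x y with h | h
  · exact ((hM.sens_contDiff x y).log fun s hs => (h s hs).ne').continuousOn_deriv_of_isOpen
      isOpen_interior le_rfl
  · refine (continuousOn_const (c := (0 : ℝ))).congr fun s hs => ?_
    have : (fun t => Real.log (M.sens x t y)) =ᶠ[𝓝 s] fun _ => 0 := by
      filter_upwards [isOpen_interior.mem_nhds hs] with t ht
      rw [h t ht, Real.log_zero]
    rw [score, this.deriv_eq, deriv_const]

lemma continuousOn_fisherInfo (hM : M.Regular) (x : X) :
    ContinuousOn (M.fisherInfo x) (interior M.stateSpace) :=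
  continuousOn_finsetSum _ fun y _ =>
    (continuousOn_sens hM x y).mul ((continuousOn_score hM x y).pow 2)

lemma continuousOn_meanFisherInfo (hM : M.Regular) (p : X → ℝ) :
    ContinuousOn (M.meanFisherInfo p) (interior M.stateSpace) :=
  continuousOn_finsetSum _ fun x _ => continuousOn_const.mul (continuousOn_fisherInfo hM x)

lemma sum_sens_mul_score (hM : M.Regular) (x : X) {s : ℝ} (hs : s ∈ interior M.stateSpace) :
    ∑ y, M.sens x s y * M.score x y s = 0 := by
  have h1 := HasDerivAt.fun_sum fun y (_ : y ∈ Finset.univ) => hasDerivAt_sens hM x y hs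
  refine h1.unique ((hasDerivAt_const s (1 : ℝ)).congr_of_eventuallyEq ?_)
  filter_upwards [isOpen_interior.mem_nhds hs] with t ht
  exact M.sens_total x t (interior_subset ht)

end Fisher

end ISACModel

/-! ### Functions with compact support in an open set -/

section Cutoff

variable {h w : ℝ → ℝ} {U : Set ℝ}

lemma continuous_mul_of_tsupport_subset (hh : Continuous h) (hU : IsOpen U) (hs : tsupport h ⊆ U)
    (hw : ContinuousOn w U) : Continuous fun s => h s * w s :=
  (hh.continuousOn.mul hw).continuous_of_tsupport_subset hU
    (closure_mono (Function.support_mul_subset_left h w) |>.trans hs)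

lemma integrable_mul_of_tsupport_subset (hh : Continuous h) (hc : HasCompactSupport h)
    (hU : IsOpen U) (hs : tsupport h ⊆ U) (hw : ContinuousOn w U) :
    Integrable fun s => h s * w s :=
  (continuous_mul_of_tsupport_subset hh hU hs hw).integrable_of_hasCompactSupport hc.mul_right

lemma tsupport_sq_subset (h : ℝ → ℝ) : tsupport (fun s => h s ^ 2) ⊆ tsupport h :=
  closure_mono fun s hs h' => hs (by simp [h'])

lemma integrable_sq_mul_of_tsupport_subset (hU : IsOpen U) (hh : Continuous h)
    (hc : HasCompactSupport h) (hs : tsupport h ⊆ U) (hw : ContinuousOn w U) :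
    Integrable fun s => h s ^ 2 * w s :=
  integrable_mul_of_tsupport_subset (hh.pow 2)
    (hc.isCompact.of_isClosed_subset (isClosed_tsupport _) (tsupport_sq_subset h)) hU
    ((tsupport_sq_subset h).trans hs) hw

end Cutoff

namespace ISACModel

variable {X Z Y : Type*} [Fintype X] [Fintype Z] [Fintype Y] {M : ISACModel X Z Y}

/-! ### The van Trees inequality -/

/-- The van Trees inequality in linearized form, for the weight `h`: integrating
`∑ y, (e y - s) p(y | s) h s` by parts expresses `∫ h` through the estimation error and the
derivative of `p(y | s) h s`, and the inequality between arithmetic and geometric mean separates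
the two. The cross term of `h'` and the score vanishes since the score is centered. -/
lemma two_mul_integral_le (hM : M.Regular) {n : ℕ} (x : Fin n → X) (e : (Fin n → Y) → ℝ)
    {h : ℝ → ℝ} (hh : ContDiff ℝ 1 h) (hc : HasCompactSupport h)
    (hsupp : tsupport h ⊆ interior M.stateSpace) {a : ℝ} (ha : 0 ≤ a)
    (hmse : ∫⁻ s, ENNReal.ofReal (∑ y : Fin n → Y,
      (s - e y) ^ 2 * ∏ i, M.sens (x i) s (y i)) ∂M.prior ≤ ENNReal.ofReal a) :
    2 * ∫ s, h s ≤ a + (∫ s, deriv h s ^ 2 * (M.density s)⁻¹) +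
      ∑ i, ∫ s, h s ^ 2 * (M.fisherInfo (x i) s / M.density s) := by
  set K := tsupport h with hK
  set I := interior M.stateSpace with hI
  have hIo : IsOpen I := isOpen_interior
  set P : (Fin n → Y) → ℝ → ℝ := fun y s => ∏ i, M.sens (x i) s (y i) with hP
  set L : (Fin n → Y) → ℝ → ℝ := fun y s => ∑ i, M.score (x i) (y i) s with hL
  set F : ℝ → ℝ := fun s => ∑ y, (s - e y) ^ 2 * P y s with hF
  set D : ℝ → ℝ := fun s => ∑ y, (e y - s) * P y s * (deriv h s + h s * L y s) with hD
  have hP0 : ∀ y, ∀ s ∈ I, 0 ≤ P y s := fun y s hs =>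
    Finset.prod_nonneg fun i _ => M.sens_nonneg _ _ (interior_subset hs) _
  have hP1 : ∀ s ∈ I, ∑ y, P y s = 1 := fun s hs =>
    sum_prod_eq_one (f := fun i => M.sens (x i) s) fun i => M.sens_total _ _ (interior_subset hs)
  have hF0 : ∀ s ∈ I, 0 ≤ F s := fun s hs =>
    Finset.sum_nonneg fun y _ => mul_nonneg (sq_nonneg _) (hP0 y s hs)
  have hPc : ∀ y, ContinuousOn (P y) I := fun y =>
    continuousOn_finsetProd _ fun i _ => continuousOn_sens hM _ _
  have hLc : ∀ y, ContinuousOn (L y) I := fun y =>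
    continuousOn_finsetSum _ fun i _ => continuousOn_score hM _ _
  have hh' : Continuous (deriv h) := hh.continuous_deriv le_rfl
  have hFc : ContinuousOn F I := continuousOn_finsetSum _ fun y _ =>
    ContinuousOn.mul (by fun_prop) (hPc y)
  have hoff : ∀ s ∉ K, h s = 0 ∧ deriv h s = 0 := fun s hs =>
    ⟨image_eq_zero_of_notMem_tsupport hs,
      image_eq_zero_of_notMem_tsupport fun h' => hs (tsupport_deriv_subset h')⟩
  -- integration by parts
  have hG : ∀ s, HasDerivAt (fun t => ∑ y, (e y - t) * P y t * h t) (D s - h s) s := by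
    intro s
    by_cases hs : s ∈ I
    · have hPd : ∀ y, HasDerivAt (P y) (P y s * L y s) s := fun y => by
        refine (HasDerivAt.fun_finsetProd fun i (_ : i ∈ Finset.univ) =>
          hasDerivAt_sens hM (x i) (y i) hs).congr_deriv ?_
        simp only [hL, hP, Finset.mul_sum, smul_eq_mul]
        refine Finset.sum_congr rfl fun i hi => ?_
        rw [← Finset.prod_erase_mul _ _ hi]
        ring
      refine (HasDerivAt.fun_sum fun y (_ : y ∈ Finset.univ) =>
        (((hasDerivAt_id s).const_sub (e y)).mul (hPd y)).mul
          (hh.differentiable one_ne_zero s).hasDerivAt).congr_deriv ?_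
      have h1 : h s = ∑ y, h s * P y s := by rw [← Finset.mul_sum, hP1 s hs, mul_one]
      conv_rhs => rw [h1]
      rw [hD, ← Finset.sum_sub_distrib]
      refine Finset.sum_congr rfl fun y _ => ?_
      simp only [id, Pi.mul_apply]
      ring
    · have hsK : s ∉ K := fun h' => hs (hsupp h')
      have h1 : D s - h s = 0 := by simp [hD, hoff s hsK]
      rw [h1]
      refine (hasDerivAt_const s (0 : ℝ)).congr_of_eventuallyEq ?_
      filter_upwards [(isClosed_tsupport h).isOpen_compl.mem_nhds hsK] with t ht
      simp [(hoff t ht).1]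
  have hcont : ∀ y, ContinuousOn (fun s => (e y - s) * P y s) I := fun y =>
    ContinuousOn.mul (by fun_prop) (hPc y)
  have hDint : Integrable D := by
    refine integrable_finsetSum _ fun y _ => ?_
    have h1 := integrable_mul_of_tsupport_subset hh' hc.deriv hIo
      (tsupport_deriv_subset.trans hsupp) (hcont y)
    have h2 := integrable_mul_of_tsupport_subset hh.continuous hc hIo hsupp
      ((hcont y).mul (hLc y))
    refine (h1.add h2).congr (ae_of_all _ fun s => ?_)
    simp only [Pi.add_apply, Pi.mul_apply]
    ring
  have hhint : Integrable h := hh.continuous.integrable_of_hasCompactSupport hc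
  have hGint : Integrable fun t => ∑ y, (e y - t) * P y t * h t := by
    refine integrable_finsetSum _ fun y _ => ?_
    exact (integrable_mul_of_tsupport_subset hh.continuous hc hIo hsupp (hcont y)).congr
      (ae_of_all _ fun s => mul_comm _ _)
  have hparts : ∫ s, D s = ∫ s, h s := by
    have := integral_eq_zero_of_hasDerivAt_of_integrable hG (hDint.sub hhint) hGint
    rw [integral_sub hDint hhint] at this
    linarith
  -- the second moment of the derivative of `p(y | s) h s`, relative to `p(y | s)`
  have hsq : ∀ s ∈ I, ∑ y, P y s * (deriv h s + h s * L y s) ^ 2 =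
      deriv h s ^ 2 + h s ^ 2 * ∑ i, M.fisherInfo (x i) s := by
    intro s hs
    have hs1 : ∀ i, ∑ a, M.sens (x i) s a = 1 := fun i => M.sens_total _ _ (interior_subset hs)
    have hs0 : ∀ i, ∑ a, M.sens (x i) s a * M.score (x i) a s = 0 := fun i =>
      sum_sens_mul_score hM _ hs
    have e1 := sum_prod_mul_sum hs1 fun i a => M.score (x i) a s
    have e2 := sum_prod_mul_sum_sq hs1 hs0
    simp only [hs0, Finset.sum_const_zero] at e1
    have e3 : ∀ y, P y s * (deriv h s + h s * L y s) ^ 2 = deriv h s ^ 2 * P y s +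
        2 * deriv h s * h s * (P y s * L y s) + h s ^ 2 * (P y s * L y s ^ 2) := fun y => by ring
    simp only [e3, Finset.sum_add_distrib, ← Finset.mul_sum, hP1 s hs]
    rw [show ∑ y, P y s * L y s = 0 from e1, show ∑ y, P y s * L y s ^ 2 = _ from e2]
    simp [fisherInfo, score]
  have hpc : ContinuousOn (fun s => (M.density s)⁻¹) I :=
    hM.density_continuous.inv₀ fun s hs => (hM.density_pos s hs).ne'
  have hJc : ∀ i, ContinuousOn (fun s => M.fisherInfo (x i) s / M.density s) I := fun i =>
    (continuousOn_fisherInfo hM (x i)).div hM.density_continuous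
      fun s hs => (hM.density_pos s hs).ne'
  have hint1 : Integrable fun s => deriv h s ^ 2 * (M.density s)⁻¹ :=
    integrable_sq_mul_of_tsupport_subset hIo hh' hc.deriv (tsupport_deriv_subset.trans hsupp) hpc
  have hint2 : ∀ i, Integrable fun s => h s ^ 2 * (M.fisherInfo (x i) s / M.density s) := fun i =>
    integrable_sq_mul_of_tsupport_subset hIo hh.continuous hc hsupp (hJc i)
  have hKc : IsCompact K := hc
  have hFpc : ContinuousOn (fun s => M.density s * F s) I := hM.density_continuous.mul hFc
  have hFint : IntegrableOn (fun s => M.density s * F s) K :=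
    (hFpc.mono hsupp).integrableOn_compact hKc
  have hKm : MeasurableSet K := hKc.measurableSet
  have hFle : ∫ s in K, M.density s * F s ≤ a := by
    rw [← ENNReal.ofReal_le_ofReal_iff ha, ofReal_integral_eq_lintegral_ofReal hFint
      ((ae_restrict_iff' hKm).2 (ae_of_all _ fun s hs =>
        mul_nonneg (hM.density_pos s (hsupp hs)).le (hF0 s (hsupp hs))))]
    refine le_trans ?_ hmse
    rw [lintegral_prior_interior]
    refine le_trans (le_of_eq ?_) (lintegral_mono_set hsupp)
    exact setLIntegral_congr_fun hKm fun s hs =>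
      ENNReal.ofReal_mul (hM.density_pos s (hsupp hs)).le
  -- arithmetic and geometric mean
  have hptw : ∀ s, 2 * D s ≤ K.indicator (fun s => M.density s * F s) s +
      deriv h s ^ 2 * (M.density s)⁻¹ +
      ∑ i, h s ^ 2 * (M.fisherInfo (x i) s / M.density s) := by
    intro s
    by_cases hs : s ∈ K
    · have hp := hM.density_pos s (hsupp hs)
      have h1 : deriv h s ^ 2 * (M.density s)⁻¹ +
          ∑ i, h s ^ 2 * (M.fisherInfo (x i) s / M.density s) =
          ∑ y, P y s * (deriv h s + h s * L y s) ^ 2 / M.density s := by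
        rw [← Finset.sum_div, hsq s (hsupp hs), ← Finset.mul_sum, ← Finset.sum_div]
        ring
      rw [Set.indicator_of_mem hs, add_assoc, h1, hD, hF, Finset.mul_sum, Finset.mul_sum,
        ← Finset.sum_add_distrib]
      refine Finset.sum_le_sum fun y _ => ?_
      have h2 : 0 ≤ P y s / M.density s *
          (M.density s * (s - e y) + (deriv h s + h s * L y s)) ^ 2 :=
        mul_nonneg (div_nonneg (hP0 y s (hsupp hs)) hp.le) (sq_nonneg _)
      have h3 : P y s / M.density s * (M.density s * (s - e y) + (deriv h s + h s * L y s)) ^ 2 =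
          M.density s * ((s - e y) ^ 2 * P y s) + P y s * (deriv h s + h s * L y s) ^ 2 /
            M.density s - 2 * ((e y - s) * P y s * (deriv h s + h s * L y s)) := by
        field_simp
        ring
      linarith
    · simp [hD, hoff s hs, Set.indicator_of_notMem hs]
  have hFint' := hFint.integrable_indicator hKm
  have hmain := integral_mono (hDint.const_mul 2)
    ((hFint'.add hint1).add (integrable_finsetSum _ fun i _ => hint2 i)) hptw
  rw [integral_const_mul, hparts, integral_add' (hFint'.add hint1)
    (integrable_finsetSum _ fun i _ => hint2 i), integral_add' hFint' hint1,
    integral_indicator hKm, integral_finsetSum _ fun i _ => hint2 i] at hmain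
  linarith

/-! ### The limiting constraints on rate and distortion -/

/-- What the van Trees inequality says about the distortion `α` in the limit of long codes with
letter distribution `p`: the linearized Cramér–Rao bound for every differentiable weight `h` with
compact support inside the state space. -/
def SensingBound (M : ISACModel X Z Y) (p : X → ℝ) (α : ℝ) : Prop :=
  ∀ h : ℝ → ℝ, ContDiff ℝ 1 h → HasCompactSupport h → tsupport h ⊆ interior M.stateSpace →
    2 * ∫ s, h s ≤ α + ∑ x, p x * ∫ s, h s ^ 2 * (M.fisherInfo x s / M.density s)

/-- The pairs of rate and distortion that satisfy, for one input distribution, the rate bound at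
every state and the sensing bound. -/
def constraintRegion (M : ISACModel X Z Y) : Set (ℝ × ℝ) :=
  {q | ∃ p ∈ stdSimplex ℝ X, (∀ s ∈ M.stateSpace, q.1 ≤ M.mutualInfo p s) ∧ M.SensingBound p q.2}

/-- By compactness of the simplex, bounds that hold in the limit along a sequence of input
distributions, for the rate only at a dense set of states, hold for one input distribution. -/
lemma mem_constraintRegion_of_tendsto (hM : M.Regular) {p : ℕ → X → ℝ}
    (hp : ∀ k, p k ∈ stdSimplex ℝ X) {R α : ℝ} {D : Set ℝ} (hDS : D ⊆ M.stateSpace)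
    (hD : M.stateSpace ⊆ closure D) {r : ℕ → ℝ → ℝ}
    (hr : ∀ s ∈ D, Tendsto (fun k => r k s) atTop (𝓝 R))
    (hr' : ∀ s ∈ D, ∀ᶠ k in atTop, r k s ≤ M.mutualInfo (p k) s)
    {b : ℕ → (ℝ → ℝ) → ℝ} (hb : ∀ h, Tendsto (fun k => b k h) atTop (𝓝 α))
    (hb' : ∀ h : ℝ → ℝ, ContDiff ℝ 1 h → HasCompactSupport h →
      tsupport h ⊆ interior M.stateSpace → ∀ᶠ k in atTop,
      2 * ∫ s, h s ≤ b k h + ∑ x, p k x * ∫ s, h s ^ 2 * (M.fisherInfo x s / M.density s)) :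
    (R, α) ∈ M.constraintRegion := by
  obtain ⟨q, hq, φ, hφ, hlim⟩ := (isCompact_stdSimplex ℝ X).tendsto_subseq hp
  refine ⟨q, hq, fun s hs => ?_, fun h h1 h2 h3 => ?_⟩
  · refine ContinuousWithinAt.closure_le (hD hs) continuousWithinAt_const
      ((hM.mutualInfo_continuous q hq s hs).mono hDS) fun t ht => ?_
    have hc := (M.continuousOn_mutualInfo (hDS ht) q hq).tendsto.comp
      (tendsto_nhdsWithin_iff.2 ⟨hlim, Eventually.of_forall fun k => hp (φ k)⟩)
    exact le_of_tendsto_of_tendsto ((hr t ht).comp hφ.tendsto_atTop) hc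
      (hφ.tendsto_atTop.eventually (hr' t ht))
  · refine ge_of_tendsto (((hb h).comp hφ.tendsto_atTop).add
      (tendsto_finsetSum _ fun x _ => (tendsto_pi_nhds.1 hlim x).mul_const _))
      (hφ.tendsto_atTop.eventually (hb' h h1 h2 h3))

lemma isClosed_constraintRegion (hM : M.Regular) : IsClosed M.constraintRegion := by
  refine IsSeqClosed.isClosed fun u q hu hlim => ?_
  choose p hp hR hα using hu
  exact mem_constraintRegion_of_tendsto hM hp (D := M.stateSpace) (R := q.1) (α := q.2) subset_rfl
    subset_closure (r := fun k _ => (u k).1) (b := fun k _ => (u k).2)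
    (fun s _ => (continuous_fst.tendsto q).comp hlim) (fun s hs => .of_forall fun k => hR k s hs)
    (fun h => (continuous_snd.tendsto q).comp hlim)
    (fun h h1 h2 h3 => .of_forall fun k => hα k h h1 h2 h3)

/-! ### Achievable pairs -/

lemma numMessages_ne_zero (R : ℝ) (n : ℕ) : numMessages R n ≠ 0 :=
  (Nat.ceil_pos.2 (by positivity)).ne'

lemma mul_log_two_le_log_numMessages (R : ℝ) (n : ℕ) :
    n * R * Real.log 2 ≤ Real.log (numMessages R n) := by
  rw [← Real.log_rpow two_pos]
  exact Real.log_le_log (by positivity) (Nat.le_ceil _)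

/-- The average error probability of a code at a given state. -/
def Code.errorAt {R : ℝ} {n : ℕ} (c : M.Code R n) (s : ℝ) : ℝ :=
  (numMessages R n : ℝ)⁻¹ * ∑ m, ∑ z : Fin n → Z,
    if c.dec z ≠ m then ∏ i, M.comm (c.enc m i) s (z i) else 0

lemma Code.errorAt_nonneg {R : ℝ} {n : ℕ} (c : M.Code R n) {s : ℝ} (hs : s ∈ M.stateSpace) :
    0 ≤ c.errorAt s := by
  refine mul_nonneg (by positivity) (Finset.sum_nonneg fun m _ => Finset.sum_nonneg fun z _ => ?_)
  split_ifs
  · exact Finset.prod_nonneg fun i _ => M.comm_nonneg _ s hs _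
  · exact le_rfl

lemma Code.aemeasurable_errorAt {R : ℝ} {n : ℕ} (c : M.Code R n) :
    AEMeasurable c.errorAt M.prior := by
  refine AEMeasurable.mono_ac ?_ (withDensity_absolutelyContinuous _ _)
  refine aemeasurable_restrict_of_measurable_subtype M.measurableSet_stateSpace ?_
  refine Measurable.const_mul (Finset.measurable_fun_sum _ fun m _ =>
    Finset.measurable_fun_sum _ fun z _ => ?_) _
  split_ifs
  · exact Finset.measurable_fun_prod _ fun i _ => M.comm_measurable _ _
  · exact measurable_const

lemma ae_mem_stateSpace : ∀ᵐ s ∂M.prior, s ∈ M.stateSpace :=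
  (withDensity_absolutelyContinuous _ _).ae_le (ae_restrict_mem M.measurableSet_stateSpace)

/-- The error probability averaged over the prior tends to zero, so along a subsequence the error
probability tends to zero at almost every state. -/
lemma exists_subseq_errorAt_tendsto {R : ℝ} {c : ∀ n, M.Code R n}
    (hc : Tendsto (fun n => (c n).errorProb) atTop (𝓝 0)) :
    ∃ ns : ℕ → ℕ, StrictMono ns ∧
      ∀ᵐ s ∂M.prior, Tendsto (fun k => (c (ns k)).errorAt s) atTop (𝓝 0) := by
  refine TendstoInMeasure.exists_seq_tendsto_ae (f := fun n => (c n).errorAt) (g := fun _ => 0) ?_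
  refine tendstoInMeasure_of_tendsto_eLpNorm one_ne_zero
    (fun n => (c n).aemeasurable_errorAt.aestronglyMeasurable) aestronglyMeasurable_const ?_
  refine hc.congr fun n => ?_
  rw [eLpNorm_one_eq_lintegral_enorm]
  refine lintegral_congr_ae ?_
  filter_upwards [M.ae_mem_stateSpace] with s hs
  simp only [Pi.sub_apply, sub_zero, Real.enorm_of_nonneg ((c n).errorAt_nonneg hs)]
  rfl

lemma Code.rate_le {R : ℝ} {n : ℕ} (hn : n ≠ 0) (c : M.Code R n) {s : ℝ} (hs : s ∈ M.stateSpace)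
    (he : c.errorAt s ≤ 1) :
    (1 - c.errorAt s) * R - (n * Real.log 2)⁻¹ ≤ M.mutualInfo (letterDist c.enc) s := by
  have h1 := fano_single_letter (numMessages_ne_zero R n) hn c.enc c.dec
    (W := fun x z => M.comm x s z) (fun x z => M.comm_nonneg x s hs z)
    fun x => M.comm_total x s hs
  have h2 := mul_le_mul_of_nonneg_left (mul_log_two_le_log_numMessages R n) (sub_nonneg.2 he)
  have h3 : (0 : ℝ) < Real.log 2 := Real.log_pos one_lt_two
  have hn' : (0 : ℝ) < n := by positivity
  rw [mutualInfo_eq, le_div_iff₀ h3, ← mul_le_mul_iff_right₀ hn']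
  refine le_trans (le_of_eq ?_) ((sub_le_sub_right h2 1).trans h1)
  field_simp

/-- The van Trees inequality for a code, averaged over the codebook; the weight is scaled down by
the length of the code, which makes the term with the derivative negligible. -/
lemma Code.sensing_le (hM : M.Regular) {R : ℝ} {n : ℕ} (hn : n ≠ 0) (c : M.Code R n) {a : ℝ}
    (ha : 0 ≤ a) (hmse : ∀ m, n * c.mse (c.enc m) ≤ ENNReal.ofReal a) {h : ℝ → ℝ}
    (hh : ContDiff ℝ 1 h) (hc : HasCompactSupport h)
    (hsupp : tsupport h ⊆ interior M.stateSpace) :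
    2 * ∫ s, h s ≤ a + (n : ℝ)⁻¹ * (∫ s, deriv h s ^ 2 * (M.density s)⁻¹) +
      ∑ x, letterDist c.enc x * ∫ s, h s ^ 2 * (M.fisherInfo x s / M.density s) := by
  have hn' : (0 : ℝ) < n := by positivity
  have hN : (0 : ℝ) < numMessages R n := by
    have := numMessages_ne_zero R n
    positivity
  set C := ∫ s, deriv h s ^ 2 * (M.density s)⁻¹ with hC
  set G : X → ℝ := fun x => ∫ s, h s ^ 2 * (M.fisherInfo x s / M.density s) with hG
  have key : ∀ m, 2 * ∫ s, h s ≤ a + (n : ℝ)⁻¹ * C + (n : ℝ)⁻¹ * ∑ i, G (c.enc m i) := by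
    intro m
    have h1 : c.mse (c.enc m) ≤ ENNReal.ofReal (a / n) := by
      rw [ENNReal.ofReal_div_of_pos hn', ENNReal.le_div_iff_mul_le (by simp [hn]) (by simp),
        ENNReal.ofReal_natCast, mul_comm]
      exact hmse m
    have h2 := two_mul_integral_le hM (c.enc m) (fun y => c.est (c.enc m) y)
      (h := fun s => (n : ℝ)⁻¹ * h s) (contDiff_const.mul hh) hc.mul_left
      ((closure_mono (Function.support_mul_subset_right _ h)).trans hsupp)
      (div_nonneg ha hn'.le) h1
    have h3 : deriv (fun s => (n : ℝ)⁻¹ * h s) = fun s => (n : ℝ)⁻¹ * deriv h s :=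
      funext fun s => deriv_const_mul _ (hh.differentiable one_ne_zero s)
    simp only [h3, mul_pow, mul_assoc, integral_const_mul, ← Finset.mul_sum] at h2
    rw [← hC] at h2
    change _ ≤ _ + _ + _ * ∑ i, G (c.enc m i) at h2
    have h4 := mul_le_mul_of_nonneg_left h2 hn'.le
    refine le_trans (le_of_eq ?_) (h4.trans (le_of_eq ?_))
    · field_simp
    · field_simp
  have hsum := Finset.sum_le_sum fun m (_ : m ∈ Finset.univ) => key m
  simp only [Finset.sum_const, Finset.card_univ, Fintype.card_fin, nsmul_eq_mul,
    Finset.sum_add_distrib, ← Finset.mul_sum] at hsum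
  rw [sum_letterDist_mul c.enc G, ← mul_le_mul_iff_right₀ hN]
  refine hsum.trans (le_of_eq ?_)
  field_simp

lemma Achievable.mem_constraintRegion (hM : M.Regular) {R α : ℝ} (hα : 0 ≤ α)
    (h : M.Achievable R α) : (R, α) ∈ M.constraintRegion := by
  obtain ⟨c, herr, hmse⟩ := h
  obtain ⟨ns, hns, hae⟩ := exists_subseq_errorAt_tendsto herr
  -- the shift by one avoids the code of length zero, which has no letter distribution
  have hns' : ∀ k, ns (k + 1) ≠ 0 := fun k => (hns.id_le (k + 1)).trans_lt' k.succ_pos |>.ne'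
  have hatTop : Tendsto (fun k => ns (k + 1)) atTop atTop :=
    hns.tendsto_atTop.comp (tendsto_add_atTop_nat 1)
  have hinv : Tendsto (fun k => ((ns (k + 1) : ℕ) : ℝ)⁻¹) atTop (𝓝 0) :=
    tendsto_inv_atTop_nhds_zero_nat.comp hatTop
  -- the limit superior allows a distortion larger than `α` by any positive amount
  have hε : ∀ ε > 0, (R, α + ε) ∈ M.constraintRegion := by
    intro ε hε
    have hev : ∀ᶠ n : ℕ in atTop, ∀ m, n * (c n).mse ((c n).enc m) ≤ ENNReal.ofReal (α + ε) := by
      have : limsup (fun n : ℕ => ⨆ m, (n : ℝ≥0∞) * (c n).mse ((c n).enc m)) atTop <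
          ENNReal.ofReal (α + ε) :=
        hmse.trans_lt ((ENNReal.ofReal_lt_ofReal_iff (by positivity)).2 (by linarith))
      filter_upwards [eventually_lt_of_limsup_lt this] with n hn m
      exact (le_iSup (fun m => (n : ℝ≥0∞) * (c n).mse ((c n).enc m)) m).trans hn.le
    refine mem_constraintRegion_of_tendsto hM
      (p := fun k => letterDist (c (ns (k + 1))).enc)
      (fun k => letterDist_mem_stdSimplex (numMessages_ne_zero _ _) (hns' k) _)
      (D := {s | s ∈ interior M.stateSpace ∧
        Tendsto (fun k => (c (ns k)).errorAt s) atTop (𝓝 0)})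
      (fun s hs => interior_subset hs.1) (M.subset_closure_of_ae_prior hM hae)
      (r := fun k s => (1 - (c (ns (k + 1))).errorAt s) * R - (ns (k + 1) * Real.log 2)⁻¹)
      (fun s hs => ?_) (fun s hs => ?_)
      (b := fun k h => α + ε + (ns (k + 1) : ℝ)⁻¹ * ∫ s, deriv h s ^ 2 * (M.density s)⁻¹)
      (fun h => ?_) (fun h h1 h2 h3 => ?_)
    · have h1 := ((hs.2.comp (tendsto_add_atTop_nat 1)).const_sub 1).mul_const R
      have h2 := h1.sub (hinv.mul_const (Real.log 2)⁻¹)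
      simpa [mul_comm, Function.comp_def] using h2
    · filter_upwards [(hs.2.comp (tendsto_add_atTop_nat 1)).eventually_le_const one_pos] with k hk
      exact Code.rate_le (hns' k) _ (interior_subset hs.1) hk
    · simpa using (hinv.mul_const (∫ s, deriv h s ^ 2 * (M.density s)⁻¹)).const_add (α + ε)
    · filter_upwards [hatTop.eventually hev] with k hk
      exact Code.sensing_le hM (hns' k) _ (by positivity) hk h1 h2 h3
  refine (isClosed_constraintRegion hM).mem_of_tendsto (b := 𝓝[>] (0 : ℝ))
    (f := fun ε => (R, α + ε)) ?_ (eventually_mem_nhdsWithin.mono hε)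
  refine (Continuous.tendsto' ?_ 0 (R, α) (by simp)).mono_left nhdsWithin_le_nhds
  fun_prop

lemma region_subset_constraintRegion (hM : M.Regular) : M.region ⊆ M.constraintRegion :=
  closure_minimal (fun _ hq => hq.2.2.mem_constraintRegion hM hq.2.1)
    (isClosed_constraintRegion hM)

lemma nonneg_of_mem_region {q : ℝ × ℝ} (hq : q ∈ M.region) : 0 ≤ q.1 ∧ 0 ≤ q.2 := by
  have : IsClosed {q : ℝ × ℝ | 0 ≤ q.1 ∧ 0 ≤ q.2} :=
    (isClosed_le continuous_const continuous_fst).inter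
      (isClosed_le continuous_const continuous_snd)
  refine closure_minimal ?_ this hq
  exact fun q hq => ⟨hq.1, hq.2.1⟩

end ISACModel

/-! ### Weights that are merely continuous -/

/-- A continuous function with compact support in an open set is the uniform limit of continuously
differentiable functions with support in one compact subset of the open set. -/
lemma exists_contDiff_seq_tendsto {f : ℝ → ℝ} (hf : Continuous f) (hc : HasCompactSupport f)
    {U : Set ℝ} (hU : IsOpen U) (hs : tsupport f ⊆ U) :
    ∃ K, IsCompact K ∧ K ⊆ U ∧ ∃ g : ℕ → ℝ → ℝ, ∀ n, ContDiff ℝ 1 (g n) ∧ tsupport (g n) ⊆ K ∧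
      ∀ x, |g n x - f x| ≤ 1 / ((n : ℝ) + 1) := by
  obtain ⟨δ, hδ, hδU⟩ := hc.isCompact.exists_cthickening_subset_open hU hs
  refine ⟨_, hc.isCompact.cthickening, hδU, ?_⟩
  have huc : UniformContinuous f := hc.uniformContinuous_of_continuous hf
  have hex : ∀ n : ℕ, ∃ g : ℝ → ℝ, ContDiff ℝ 1 g ∧
      tsupport g ⊆ Metric.cthickening δ (tsupport f) ∧ ∀ x, |g x - f x| ≤ 1 / ((n : ℝ) + 1) := by
    intro n
    obtain ⟨r, hr, hrf⟩ := Metric.uniformContinuous_iff.1 huc (1 / ((n : ℝ) + 1)) (by positivity)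
    obtain ⟨g, hg, hgf⟩ :=
      hf.exists_contDiff_dist_le_of_forall_mem_ball_dist_le (lt_min hr hδ)
    refine ⟨g, hg.of_le (by simp), closure_minimal (fun x hx => ?_) Metric.isClosed_cthickening,
      fun x => ?_⟩
    · by_contra h'
      have h0 : ∀ y ∈ Metric.ball x (min r δ), f y = 0 := fun y hy => by
        by_contra h0
        exact h' (Metric.mem_cthickening_of_dist_le x y δ _ (subset_tsupport f h0)
          (by rw [dist_comm]; exact (hy.trans_le (min_le_right _ _)).le))
      have h1 : f x = 0 := h0 x (Metric.mem_ball_self (lt_min hr hδ))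
      have := hgf x 0 fun y hy => by simp [h0 y hy, h1]
      rw [h1, dist_le_zero] at this
      exact hx this
    · exact hgf x _ fun y hy => (hrf (hy.trans_le (min_le_left _ _))).le
  choose g hg using hex
  exact ⟨g, hg⟩

/-- If `A` were positive the linear term would dominate for small `t`. -/
lemma nonpos_of_forall_mul_le_sq {A c : ℝ} (h : ∀ t > 0, 2 * (t * A) ≤ t ^ 2 * c) : A ≤ 0 := by
  by_contra! hA
  have hc : 0 < |c| + 1 := by positivity
  have h1 := h (A / (|c| + 1)) (by positivity)
  have h2 : (A / (|c| + 1)) ^ 2 * c ≤ (A / (|c| + 1)) ^ 2 * (|c| + 1) :=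
    mul_le_mul_of_nonneg_left (by linarith [le_abs_self c]) (sq_nonneg _)
  have h3 : (A / (|c| + 1)) ^ 2 * (|c| + 1) = A / (|c| + 1) * A := by field_simp
  have h4 : 0 < A / (|c| + 1) * A := by positivity
  linarith

namespace ISACModel

variable {X Z Y : Type*} [Fintype X] [Fintype Z] [Fintype Y] {M : ISACModel X Z Y}

section SensingBound

variable {p : X → ℝ} {α : ℝ}

lemma continuousOn_meanFisherInfo_div (hM : M.Regular) (p : X → ℝ) :
    ContinuousOn (fun s => M.meanFisherInfo p s / M.density s) (interior M.stateSpace) :=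
  (continuousOn_meanFisherInfo hM p).div hM.density_continuous
    fun s hs => (hM.density_pos s hs).ne'

lemma sum_mul_integral_fisherInfo (hM : M.Regular) (p : X → ℝ) {h : ℝ → ℝ} (hh : Continuous h)
    (hc : HasCompactSupport h) (hs : tsupport h ⊆ interior M.stateSpace) :
    ∑ x, p x * ∫ s, h s ^ 2 * (M.fisherInfo x s / M.density s) =
      ∫ s, h s ^ 2 * (M.meanFisherInfo p s / M.density s) := by
  simp_rw [← integral_const_mul]
  rw [← integral_finsetSum]
  · refine integral_congr_ae (ae_of_all _ fun s => ?_)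
    simp only [meanFisherInfo, Finset.sum_div, Finset.mul_sum]
    exact Finset.sum_congr rfl fun x _ => by ring
  · intro x _
    refine (integrable_sq_mul_of_tsupport_subset isOpen_interior hh hc hs ?_).const_mul _
    exact (continuousOn_fisherInfo hM x).div hM.density_continuous
      fun s hs => (hM.density_pos s hs).ne'

lemma SensingBound.of_continuous (hM : M.Regular) (hb : M.SensingBound p α) {f : ℝ → ℝ}
    (hf : Continuous f) (hc : HasCompactSupport f) (hs : tsupport f ⊆ interior M.stateSpace) :
    2 * ∫ s, f s ≤ α + ∫ s, f s ^ 2 * (M.meanFisherInfo p s / M.density s) := by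
  obtain ⟨K, hK, hKI, g, hg⟩ := exists_contDiff_seq_tendsto hf hc isOpen_interior hs
  set w := fun s => M.meanFisherInfo p s / M.density s with hw
  have hwc : ContinuousOn w K := (continuousOn_meanFisherInfo_div hM p).mono hKI
  have hgc : ∀ n, HasCompactSupport (g n) := fun n =>
    hK.of_isClosed_subset (isClosed_tsupport _) (hg n).2.1
  have hle : ∀ n, 2 * ∫ s, g n s ≤ α + ∫ s, g n s ^ 2 * w s := fun n => by
    rw [← sum_mul_integral_fisherInfo hM p (hg n).1.continuous (hgc n) ((hg n).2.1.trans hKI)]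
    exact hb (g n) (hg n).1 (hgc n) ((hg n).2.1.trans hKI)
  have hg0 : ∀ n, ∀ s ∉ K, g n s = 0 := fun n s hsK =>
    image_eq_zero_of_notMem_tsupport fun h' => hsK ((hg n).2.1 h')
  have hgabs : ∀ n s, |g n s| ≤ |f s| + 1 := fun n s => by
    have h1 := (hg n).2.2 s
    have h2 : 1 / ((n : ℝ) + 1) ≤ 1 := by
      rw [div_le_one (by positivity)]
      linarith [n.cast_nonneg (α := ℝ)]
    have h3 := abs_sub_abs_le_abs_sub (g n s) (f s)
    linarith
  have hlim : ∀ s, Tendsto (fun n => g n s) atTop (𝓝 (f s)) := fun s => by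
    rw [tendsto_iff_dist_tendsto_zero]
    exact squeeze_zero (fun n => dist_nonneg) (fun n => (hg n).2.2 s)
      tendsto_one_div_add_atTop_nhds_zero_nat
  have hb1 : Integrable (K.indicator fun s => |f s| + 1) :=
    IntegrableOn.integrable_indicator (ContinuousOn.integrableOn_compact hK (by fun_prop))
      hK.measurableSet
  have hb2 : Integrable (K.indicator fun s => (|f s| + 1) ^ 2 * |w s|) :=
    IntegrableOn.integrable_indicator
      (ContinuousOn.integrableOn_compact hK (ContinuousOn.mul (by fun_prop) hwc.abs))
      hK.measurableSet
  have ht1 : Tendsto (fun n => ∫ s, g n s) atTop (𝓝 (∫ s, f s)) := by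
    refine tendsto_integral_of_dominated_convergence _
      (fun n => (hg n).1.continuous.aestronglyMeasurable) hb1 (fun n => ae_of_all _ fun s => ?_)
      (ae_of_all _ hlim)
    by_cases hsK : s ∈ K
    · simpa [hsK] using hgabs n s
    · simp [hsK, hg0 n s hsK]
  have ht2 : Tendsto (fun n => ∫ s, g n s ^ 2 * w s) atTop (𝓝 (∫ s, f s ^ 2 * w s)) := by
    refine tendsto_integral_of_dominated_convergence _
      (fun n => (integrable_sq_mul_of_tsupport_subset isOpen_interior (hg n).1.continuous (hgc n) ((hg n).2.1.trans hKI)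
        (continuousOn_meanFisherInfo_div hM p)).aestronglyMeasurable) hb2
      (fun n => ae_of_all _ fun s => ?_)
      (ae_of_all _ fun s => ((hlim s).pow 2).mul_const _)
    by_cases hsK : s ∈ K
    · simp only [Set.indicator_of_mem hsK, norm_mul, norm_pow, Real.norm_eq_abs]
      gcongr
      exact hgabs n s
    · simp [hsK, hg0 n s hsK]
  exact le_of_tendsto_of_tendsto' (ht1.const_mul 2) (ht2.const_add α) hle

/-! ### From the sensing bound to the Fisher information -/

/-- The sensing bound rules out distortion zero: for a small multiple of a fixed weight, the linear
term exceeds the quadratic one. -/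
lemma SensingBound.pos (hM : M.Regular) (hb : M.SensingBound p α) : 0 < α := by
  by_contra! hα
  obtain ⟨s₀, hs₀⟩ := M.stateSpace_interior
  obtain ⟨χ, hχ1, hχc, hχs, hχ⟩ := exists_continuousMap_one_of_isCompact_subset_isOpen
    (isCompact_singleton (x := s₀)) isOpen_interior (Set.singleton_subset_iff.2 hs₀)
  have hpos : 0 < ∫ s, χ s := χ.continuous.integral_pos_of_hasCompactSupport_nonneg_nonzero hχc
    (fun s => (hχ s).1) (x := s₀) (by simp [hχ1 rfl])
  refine hpos.not_ge (nonpos_of_forall_mul_le_sq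
    (c := ∫ s, χ s ^ 2 * (M.meanFisherInfo p s / M.density s)) fun t _ => ?_)
  have h1 := hb.of_continuous hM (f := fun s => t * χ s) (by fun_prop)
    (HasCompactSupport.mul_left hχc)
    ((closure_mono (Function.support_mul_subset_right _ _)).trans hχs)
  simp only [mul_pow, mul_assoc, integral_const_mul] at h1
  linarith

lemma ae_mem_interior : ∀ᵐ s ∂M.prior, s ∈ interior M.stateSpace := by
  refine (withDensity_absolutelyContinuous _ _).ae_le ?_
  rw [← restrict_interior_eq]
  exact ae_restrict_mem isOpen_interior.measurableSet

/-- Cutoffs inside the state space that equal one on a given compact set and lose little of the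
mass of the prior. -/
lemma exists_cutoff (hM : M.Regular) {K : Set ℝ} (hK : IsCompact K)
    (hKI : K ⊆ interior M.stateSpace) {ε : ℝ} (hε : 0 < ε) :
    ∃ χ : C(ℝ, ℝ), Set.EqOn χ 1 K ∧ HasCompactSupport χ ∧ tsupport χ ⊆ interior M.stateSpace ∧
      (∀ s, χ s ∈ Set.Icc (0 : ℝ) 1) ∧ 1 - ε ≤ ∫ s, χ s * M.density s := by
  have hI1 : M.prior (interior M.stateSpace) = 1 :=
    (mem_ae_iff_prob_eq_one isOpen_interior.measurableSet).1 ae_mem_interior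
  obtain ⟨K', hK'I, hK', hlt⟩ :=
    (isOpen_interior (s := M.stateSpace)).measurableSet.exists_lt_isCompact_of_ne_top
    (measure_ne_top M.prior _) (r := ENNReal.ofReal (1 - ε)) (by
      rw [hI1]
      exact ENNReal.ofReal_lt_one.2 (by linarith))
  obtain ⟨χ, hχ1, hχc, hχs, hχ⟩ := exists_continuousMap_one_of_isCompact_subset_isOpen
    (hK.union hK') isOpen_interior (Set.union_subset hKI hK'I)
  refine ⟨χ, fun s hs => hχ1 (Or.inl hs), hχc, hχs, hχ, ?_⟩
  have h0 : ∀ s, 0 ≤ χ s * M.density s := fun s => by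
    by_cases hs : s ∈ interior M.stateSpace
    · exact mul_nonneg (hχ s).1 (hM.density_pos s hs).le
    · simp [image_eq_zero_of_notMem_tsupport fun h' => hs (hχs h')]
  rw [← ENNReal.ofReal_le_ofReal_iff (integral_nonneg h0)]
  refine hlt.le.trans ?_
  rw [ofReal_integral_eq_lintegral_ofReal (integrable_mul_of_tsupport_subset χ.continuous hχc
    isOpen_interior hχs hM.density_continuous) (ae_of_all _ h0),
    ← lintegral_indicator_one hK'.measurableSet, lintegral_prior_interior]
  refine le_trans (lintegral_mono fun s => ?_) (setLIntegral_le_lintegral _ _)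
  by_cases hs : s ∈ K'
  · simp [hs, hχ1 (Or.inr hs)]
  · simp [hs]

/-- The sensing bound for weights near `α` times the prior density, the optimal weight when the
Fisher information is constant. -/
lemma SensingBound.perturbed (hM : M.Regular) (hp : p ∈ stdSimplex ℝ X)
    (hb : M.SensingBound p α) (hB : M.bayesFisherInfo p ≠ ∞) {ψ : ℝ → ℝ} (hψ : Continuous ψ)
    (hc : HasCompactSupport ψ) (hs : tsupport ψ ⊆ interior M.stateSpace) :
    2 * α + 2 * ∫ s, ψ s ≤ α + α ^ 2 * (M.bayesFisherInfo p).toReal +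
      2 * α * (∫ s, ψ s * M.meanFisherInfo p s) +
      ∫ s, ψ s ^ 2 * (M.meanFisherInfo p s / M.density s) := by
  have hα := hb.pos hM
  refine le_of_forall_pos_le_add fun ε hε => ?_
  obtain ⟨χ, hχ1, hχc, hχs, hχ, hχε⟩ := exists_cutoff hM hc.isCompact hs
    (ε := ε / (2 * α)) (by positivity)
  have hJ := continuousOn_meanFisherInfo hM p
  have hI : IsOpen (interior M.stateSpace) := isOpen_interior
  have hχp : Continuous fun s => χ s * M.density s :=
    continuous_mul_of_tsupport_subset χ.continuous hI hχs hM.density_continuous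
  have hoff : ∀ s ∉ tsupport χ, χ s = 0 ∧ ψ s = 0 := fun s h' => by
    refine ⟨image_eq_zero_of_notMem_tsupport h', image_eq_zero_of_notMem_tsupport fun h'' => h' ?_⟩
    exact subset_tsupport _ (by simp [hχ1 h''])
  have hsub : tsupport (fun s => α * (χ s * M.density s) + ψ s) ⊆ tsupport χ := by
    refine closure_minimal (fun s hs' => ?_) (isClosed_tsupport _)
    by_contra h'
    exact hs' (by simp [hoff s h'])
  have h1 := hb.of_continuous hM (f := fun s => α * (χ s * M.density s) + ψ s) (by fun_prop)
    (hχc.isCompact.of_isClosed_subset (isClosed_tsupport _) hsub) (hsub.trans hχs)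
  have hint1 : Integrable fun s => χ s * M.density s :=
    integrable_mul_of_tsupport_subset χ.continuous hχc hI hχs hM.density_continuous
  have hint2 : Integrable fun s => χ s ^ 2 * (M.density s * M.meanFisherInfo p s) :=
    integrable_sq_mul_of_tsupport_subset isOpen_interior χ.continuous hχc hχs (hM.density_continuous.mul hJ)
  have hint3 : Integrable fun s => ψ s * M.meanFisherInfo p s :=
    integrable_mul_of_tsupport_subset hψ hc hI hs hJ
  have hint4 : Integrable fun s => ψ s ^ 2 * (M.meanFisherInfo p s / M.density s) :=
    integrable_sq_mul_of_tsupport_subset isOpen_interior hψ hc hs (continuousOn_meanFisherInfo_div hM p)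
  have hexp : ∀ s, (α * (χ s * M.density s) + ψ s) ^ 2 * (M.meanFisherInfo p s / M.density s) =
      α ^ 2 * (χ s ^ 2 * (M.density s * M.meanFisherInfo p s)) +
        2 * α * (ψ s * M.meanFisherInfo p s) +
        ψ s ^ 2 * (M.meanFisherInfo p s / M.density s) := fun s => by
    by_cases hsI : s ∈ interior M.stateSpace
    · have hd := (hM.density_pos s hsI).ne'
      by_cases h' : s ∈ tsupport ψ
      · simp only [hχ1 h', Pi.one_apply]
        field_simp
        ring
      · simp only [image_eq_zero_of_notMem_tsupport h']
        field_simp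
        ring
    · simp [hoff s fun h' => hsI (hχs h')]
  have hBle : ∫ s, χ s ^ 2 * (M.density s * M.meanFisherInfo p s) ≤
      (M.bayesFisherInfo p).toReal := by
    have h0 : ∀ s ∈ interior M.stateSpace, 0 ≤ M.density s * M.meanFisherInfo p s := fun s hs =>
      mul_nonneg (hM.density_pos s hs).le (M.meanFisherInfo_nonneg hp (interior_subset hs))
    have hzero : ∀ s ∉ interior M.stateSpace, χ s = 0 := fun s hs =>
      (hoff s fun h' => hs (hχs h')).1
    rw [← ENNReal.ofReal_le_ofReal_iff ENNReal.toReal_nonneg, ENNReal.ofReal_toReal hB,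
      ofReal_integral_eq_lintegral_ofReal hint2 (ae_of_all _ fun s => by
        by_cases hsI : s ∈ interior M.stateSpace
        · exact mul_nonneg (sq_nonneg _) (h0 s hsI)
        · simp [hzero s hsI]),
      bayesFisherInfo, lintegral_prior_interior, ← lintegral_indicator hI.measurableSet]
    refine lintegral_mono fun s => ?_
    by_cases hsI : s ∈ interior M.stateSpace
    · simp only [Set.indicator_of_mem hsI]
      rw [← ENNReal.ofReal_mul (hM.density_pos s hsI).le]
      exact ENNReal.ofReal_le_ofReal (mul_le_of_le_one_left (h0 s hsI)
        (pow_le_one₀ (hχ s).1 (hχ s).2))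
    · simp [hzero s hsI]
  simp_rw [hexp] at h1
  have hint23 : Integrable fun s => α ^ 2 * (χ s ^ 2 * (M.density s * M.meanFisherInfo p s)) +
      2 * α * (ψ s * M.meanFisherInfo p s) := (hint2.const_mul _).add (hint3.const_mul _)
  rw [integral_add hint23 hint4,
    integral_add (hint2.const_mul _) (hint3.const_mul _),
    integral_add (hint1.const_mul _) (hψ.integrable_of_hasCompactSupport hc)] at h1
  simp only [integral_const_mul] at h1
  have h2 := mul_le_mul_of_nonneg_left hBle (sq_nonneg α)
  have h3 := mul_le_mul_of_nonneg_left hχε (by positivity : 0 ≤ 2 * α)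
  rw [mul_sub, mul_div_cancel₀ _ (by positivity : 2 * α ≠ 0)] at h3
  linarith

lemma SensingBound.one_le (hM : M.Regular) (hp : p ∈ stdSimplex ℝ X) (hb : M.SensingBound p α)
    (hB : M.bayesFisherInfo p ≠ ∞) : 1 ≤ α * (M.bayesFisherInfo p).toReal := by
  have h := hb.perturbed hM hp hB (ψ := fun _ => 0) continuous_const HasCompactSupport.zero
    (by simp)
  simp only [integral_zero, mul_zero, add_zero, zero_mul, ne_eq, OfNat.ofNat_ne_zero,
    not_false_eq_true, zero_pow] at h
  rw [← mul_le_mul_iff_right₀ (hb.pos hM)]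
  linarith

/-- The case of equality: `α` times the prior density is then an optimal weight, and stationarity
makes the Fisher information constant. -/
lemma SensingBound.fisherIndep (hM : M.Regular) (hp : p ∈ stdSimplex ℝ X)
    (hb : M.SensingBound p α) (hB : M.bayesFisherInfo p ≠ ∞)
    (heq : α * (M.bayesFisherInfo p).toReal = 1) : M.FisherIndep p := by
  have hα := hb.pos hM
  suffices h : ∀ s ∈ interior M.stateSpace, α * M.meanFisherInfo p s = 1 from fun s hs t ht =>
    mul_left_cancel₀ hα.ne' ((h s hs).trans (h t ht).symm)
  intro s₀ hs₀
  by_contra hne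
  obtain ⟨χ, hχ1, hχc, hχs, hχ⟩ := exists_continuousMap_one_of_isCompact_subset_isOpen
    (isCompact_singleton (x := s₀)) isOpen_interior (Set.singleton_subset_iff.2 hs₀)
  have hJ := continuousOn_meanFisherInfo hM p
  have hd : ContinuousOn (fun s => 1 - α * M.meanFisherInfo p s) (interior M.stateSpace) :=
    continuousOn_const.sub (continuousOn_const.mul hJ)
  set ψ : ℝ → ℝ := fun s => χ s * (1 - α * M.meanFisherInfo p s) with hψ
  have hψc : Continuous ψ :=
    continuous_mul_of_tsupport_subset χ.continuous isOpen_interior hχs hd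
  have hψs : HasCompactSupport ψ := HasCompactSupport.mul_right hχc
  have hψI : tsupport ψ ⊆ interior M.stateSpace :=
    (closure_mono (Function.support_mul_subset_left _ _)).trans hχs
  have hint := integrable_mul_of_tsupport_subset hψc hψs isOpen_interior hψI hJ
  -- the first variation in the direction `ψ` is the integral of `χ (1 - α J) ^ 2`
  have hpos : 0 < ∫ s, ψ s * (1 - α * M.meanFisherInfo p s) := by
    refine (continuous_mul_of_tsupport_subset hψc isOpen_interior hψI
      hd).integral_pos_of_hasCompactSupport_nonneg_nonzero hψs.mul_right (x := s₀) (fun s => ?_) ?_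
    · simp only [hψ, Pi.zero_apply, mul_assoc]
      exact mul_nonneg (hχ s).1 (mul_self_nonneg _)
    · have h1 : 1 - α * M.meanFisherInfo p s₀ ≠ 0 := sub_ne_zero.2 (Ne.symm hne)
      simpa [hψ, hχ1 rfl] using h1
  refine hpos.not_ge (nonpos_of_forall_mul_le_sq
    (c := ∫ s, ψ s ^ 2 * (M.meanFisherInfo p s / M.density s)) fun t _ => ?_)
  have h1 := hb.perturbed hM hp hB (ψ := fun s => t * ψ s) (by fun_prop) hψs.mul_left
    ((closure_mono (Function.support_mul_subset_right _ _)).trans hψI)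
  have h2 : ∫ s, ψ s * (1 - α * M.meanFisherInfo p s) =
      (∫ s, ψ s) - α * ∫ s, ψ s * M.meanFisherInfo p s := by
    rw [← integral_const_mul, ← integral_sub (hψc.integrable_of_hasCompactSupport hψs)
      (hint.const_mul _)]
    exact integral_congr_ae (ae_of_all _ fun s => by ring)
  simp only [mul_pow, mul_assoc, integral_const_mul] at h1
  rw [h2]
  have h3 : α ^ 2 * (M.bayesFisherInfo p).toReal = α := by
    rw [sq, mul_assoc, heq, mul_one]
  rw [h3] at h1
  linarith

end SensingBound

/-! ### The outer region -/

lemma SensingBound.inv_bayesFisherInfo_le (hM : M.Regular) {p : X → ℝ} {α : ℝ}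
    (hp : p ∈ stdSimplex ℝ X) (hb : M.SensingBound p α) :
    (M.bayesFisherInfo p)⁻¹ ≤ ENNReal.ofReal α := by
  by_cases hB : M.bayesFisherInfo p = ∞
  · simp [hB]
  have h1 := hb.one_le hM hp hB
  have hpos : 0 < (M.bayesFisherInfo p).toReal :=
    pos_of_mul_pos_right (one_pos.trans_le h1) (hb.pos hM).le
  rw [← ENNReal.ofReal_toReal hB, ← ENNReal.ofReal_inv_of_pos hpos]
  refine ENNReal.ofReal_le_ofReal ?_
  rwa [inv_le_iff_one_le_mul₀ hpos]

lemma le_iInf_mutualInfo {p : X → ℝ} {R : ℝ} (h : ∀ s ∈ M.stateSpace, R ≤ M.mutualInfo p s) :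
    R ≤ ⨅ s : M.stateSpace, M.mutualInfo p s :=
  have : Nonempty M.stateSpace := (M.stateSpace_interior.mono interior_subset).to_subtype
  le_ciInf fun s => h s s.2

lemma region_subset_outerRegion (hM : M.Regular) : M.region ⊆ M.outerRegion := by
  intro q hq
  obtain ⟨p, hp, hR, hb⟩ := region_subset_constraintRegion hM hq
  exact ⟨(nonneg_of_mem_region hq).1, (nonneg_of_mem_region hq).2, p, hp, le_iInf_mutualInfo hR,
    hb.inv_bayesFisherInfo_le hM hp⟩

lemma inv_le_ofReal_toReal_inv {B : ℝ≥0∞} (hB : B ≠ 0) : B⁻¹ ≤ ENNReal.ofReal B.toReal⁻¹ := by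
  rw [← ENNReal.toReal_inv, ENNReal.ofReal_toReal (ENNReal.inv_ne_top.2 hB)]

/-- A pair of the region with the least distortion in the outer region attains equality in the
Bayesian Cramér–Rao bound. -/
lemma exists_fisherIndep_of_mem_region (hM : M.Regular) {R α : ℝ}
    (hmin : ∀ α' : ℝ, (R, α') ∈ M.outerRegion → α ≤ α') (hmem : (R, α) ∈ M.region) :
    ∃ p ∈ stdSimplex ℝ X, M.OuterBound p R α ∧ M.FisherIndep p := by
  obtain ⟨p, hp, hR, hb⟩ := region_subset_constraintRegion hM hmem
  have hle := hb.inv_bayesFisherInfo_le hM hp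
  refine ⟨p, hp, ⟨le_iInf_mutualInfo hR, hle⟩, ?_⟩
  have h0 : M.bayesFisherInfo p ≠ 0 := by
    rintro h
    simp [h] at hle
  have hα : α ≤ (M.bayesFisherInfo p).toReal⁻¹ :=
    hmin _ ⟨(nonneg_of_mem_region hmem).1, by positivity, p, hp, le_iInf_mutualInfo hR,
      inv_le_ofReal_toReal_inv h0⟩
  have hpos := hb.pos hM
  have hB : M.bayesFisherInfo p ≠ ∞ := fun h => by
    simp only [h, ENNReal.toReal_top, inv_zero] at hα
    exact hpos.not_ge hα
  refine hb.fisherIndep hM hp hB (le_antisymm ?_ (hb.one_le hM hp hB))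
  have hBpos : 0 < (M.bayesFisherInfo p).toReal := ENNReal.toReal_pos h0 hB
  calc α * (M.bayesFisherInfo p).toReal
      ≤ (M.bayesFisherInfo p).toReal⁻¹ * (M.bayesFisherInfo p).toReal := by gcongr
    _ = 1 := inv_mul_cancel₀ hBpos.ne'

/-! ### The least distortion -/

lemma aemeasurable_of_continuousOn_interior {f : ℝ → ℝ}
    (hf : ContinuousOn f (interior M.stateSpace)) : AEMeasurable f M.prior := by
  refine AEMeasurable.mono_ac ?_ (withDensity_absolutelyContinuous _ _)
  rw [← restrict_interior_eq]
  exact hf.aemeasurable isOpen_interior.measurableSet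

lemma bayesFisherInfo_ne_zero_iff (hM : M.Regular) {p : X → ℝ} (hp : p ∈ stdSimplex ℝ X) :
    M.bayesFisherInfo p ≠ 0 ↔ M.Informative p := by
  have hJ := continuousOn_meanFisherInfo hM p
  rw [bayesFisherInfo, Ne,
    lintegral_eq_zero_iff' (aemeasurable_of_continuousOn_interior hJ).ennreal_ofReal]
  constructor
  · contrapose!
    intro h
    filter_upwards [ae_mem_interior] with s hs
    have h' : M.meanFisherInfo p s = 0 := by
      by_contra h'
      exact h ⟨s, hs, h'⟩
    simp [h']
  · rintro ⟨s, hs, hne⟩ h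
    refine hne (le_antisymm ?_ (M.meanFisherInfo_nonneg hp (interior_subset hs)))
    have hcl := M.subset_closure_of_ae_prior hM h (interior_subset hs)
    exact ContinuousWithinAt.closure_le hcl ((hJ s hs).mono fun t ht => ht.1)
      continuousWithinAt_const fun t ht => by simpa using ht.2

/-- Bayesian Fisher information is linear in the input distribution, so a point mass maximizes it. -/
lemma exists_bayesFisherInfo_max (hM : M.Regular) [Nonempty X] :
    ∃ p ∈ stdSimplex ℝ X, ∀ q ∈ stdSimplex ℝ X, M.bayesFisherInfo q ≤ M.bayesFisherInfo p := by
  classical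
  obtain ⟨x₀, hx₀⟩ := Finite.exists_max fun x => ∫⁻ s, ENNReal.ofReal (M.fisherInfo x s) ∂M.prior
  refine ⟨Pi.single x₀ 1, single_mem_stdSimplex ℝ x₀, fun q hq => ?_⟩
  have h0 : M.bayesFisherInfo (Pi.single x₀ 1) =
      ∫⁻ s, ENNReal.ofReal (M.fisherInfo x₀ s) ∂M.prior := by
    simp [bayesFisherInfo, meanFisherInfo, Pi.single_apply]
  calc M.bayesFisherInfo q
      = ∫⁻ s, ∑ x, ENNReal.ofReal (q x) * ENNReal.ofReal (M.fisherInfo x s) ∂M.prior := by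
        refine lintegral_congr_ae ?_
        filter_upwards [ae_mem_stateSpace] with s hs
        rw [meanFisherInfo, ENNReal.ofReal_sum_of_nonneg fun x _ =>
          mul_nonneg (hq.1 x) (M.fisherInfo_nonneg x hs)]
        exact Finset.sum_congr rfl fun x _ => ENNReal.ofReal_mul (hq.1 x)
    _ = ∑ x, ENNReal.ofReal (q x) * ∫⁻ s, ENNReal.ofReal (M.fisherInfo x s) ∂M.prior := by
        have hm : ∀ x, AEMeasurable (fun s => ENNReal.ofReal (M.fisherInfo x s)) M.prior :=
          fun x => (aemeasurable_of_continuousOn_interior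
            (continuousOn_fisherInfo hM x)).ennreal_ofReal
        rw [lintegral_finsetSum' _ fun x _ => (hm x).const_mul _]
        exact Finset.sum_congr rfl fun x _ => lintegral_const_mul'' _ (hm x)
    _ ≤ ∑ x, ENNReal.ofReal (q x) * M.bayesFisherInfo (Pi.single x₀ 1) := by
        gcongr with x
        rw [h0]
        exact hx₀ x
    _ = M.bayesFisherInfo (Pi.single x₀ 1) := by
        rw [← Finset.sum_mul, ← ENNReal.ofReal_sum_of_nonneg fun x _ => hq.1 x, hq.2]
        simp

/-- At rate zero the outer region has a least distortion as soon as some input distribution is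
informative. -/
lemma exists_least_distortion (hM : M.Regular) (hinf : ∃ p ∈ stdSimplex ℝ X, M.Informative p) :
    ∃ α : ℝ, (0, α) ∈ M.outerRegion ∧ (∀ α' : ℝ, (0, α') ∈ M.outerRegion → α ≤ α') := by
  obtain ⟨q, hq, hqinf⟩ := hinf
  have : Nonempty X := by
    by_contra h
    rw [not_nonempty_iff] at h
    simpa using hq.2
  obtain ⟨p, hp, hmax⟩ := exists_bayesFisherInfo_max hM
  have h0 : M.bayesFisherInfo p ≠ 0 :=
    (((pos_iff_ne_zero.2 ((bayesFisherInfo_ne_zero_iff hM hq).2 hqinf))).trans_le (hmax q hq)).ne'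
  refine ⟨(M.bayesFisherInfo p).toReal⁻¹, ⟨le_rfl, by positivity, p, hp,
    le_iInf_mutualInfo fun s hs => M.mutualInfo_nonneg hp hs, inv_le_ofReal_toReal_inv h0⟩, ?_⟩
  rintro α' ⟨-, hα', p', hp', -, hle⟩
  rw [← ENNReal.ofReal_le_ofReal_iff hα', ← ENNReal.toReal_inv,
    ENNReal.ofReal_toReal (ENNReal.inv_ne_top.2 h0)]
  exact (ENNReal.inv_le_inv.2 (hmax p' hp')).trans hle

lemma OuterBound.informative (hM : M.Regular) {p : X → ℝ} (hp : p ∈ stdSimplex ℝ X) {R α : ℝ}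
    (h : M.OuterBound p R α) : M.Informative p := by
  refine (bayesFisherInfo_ne_zero_iff hM hp).1 fun h0 => ?_
  have := h.2
  simp [h0] at this

end ISACModel

end

theorem corollary1 {X Z Y : Type*} [Fintype X] [Fintype Z] [Fintype Y]
    (M : ISACModel X Z Y) (hM : M.Regular) :
    -- outer bound
    M.region ⊆ M.outerRegion ∧
    -- the inclusion is strict unless some informative input distribution has state-independent
    -- Fisher information (or no input distribution is informative: then there is nothing to bound)
    ((∃ p ∈ stdSimplex ℝ X, M.Informative p) →
      (∀ p ∈ stdSimplex ℝ X, M.Informative p → ¬ M.FisherIndep p) →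
        M.region ⊂ M.outerRegion) ∧
    -- locally: a pair of the outer region with the least `α` for its rate is outside the region,
    -- unless some input distribution that gives the pair has state-independent Fisher information
    (∀ R α : ℝ, (R, α) ∈ M.outerRegion → (∀ α' : ℝ, (R, α') ∈ M.outerRegion → α ≤ α') →
      (∀ p ∈ stdSimplex ℝ X, M.OuterBound p R α → ¬ M.FisherIndep p) →
        (R, α) ∉ M.region) := by
  refine ⟨ISACModel.region_subset_outerRegion hM, fun hinf hindep => ?_,
    fun R α _ hmin hindep hmem => ?_⟩
  · obtain ⟨α, hα, hmin⟩ := ISACModel.exists_least_distortion hM hinf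
    refine (Set.ssubset_iff_of_subset (ISACModel.region_subset_outerRegion hM)).2
      ⟨(0, α), hα, fun hmem => ?_⟩
    obtain ⟨p, hp, hb, hJ⟩ := ISACModel.exists_fisherIndep_of_mem_region hM hmin hmem
    exact hindep p hp (hb.informative hM hp) hJ
  · obtain ⟨p, hp, hb, hJ⟩ := ISACModel.exists_fisherIndep_of_mem_region hM hmin hmem
    exact hindep p hp hb hJ
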